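/- Let $q\in\mathbb{C}$ with $|q|<1$. Write $(a;q)_n=\prod_{j=0}^{n-1}(1-aq^j)$, $(a;q)_\infty=\prod_{j\ge 0}(1-aq^j)$, $(a_1,\dots,a_r;q)_\infty=\prod_{i=1}^r(a_i;q)_\infty$, $(q)_n=(q;q)_n$ and $(q)_\infty=(q;q)_\infty$. For integers $m,n$ let ${n+m\brack n}_q=\frac{(q)_{n+m}}{(q)_n(q)_m}$ if $m,n\ge 0$, and ${n+m\brack n}_q=0$ otherwise; ${a\brack b}_{q^2}$ denotes the same expression with $q$ replaced by $q^2$. Let $v\ge 2$ be an integer, and for nonnegative integers $n_1,\dots,n_{v-1}$ put $N_j=n_j+n_{j+1}+\cdots+n_{v-1}$. Then the following three identities hold, all multisums being absolutely convergent. (1.5) For every integer $\Delta$ with $0\le\Delta<v$, $$\sum_{m,k,n_1,\dots,n_{v-1}\ge 0}\frac{q^{(m+k)^2+k^2+\Delta(m+2k)+\sum_{j=1}^{v-1}N_j^2+\sum_{t=v-\Delta}^{v-1}N_t}}{(q)_m(q)_{2k+\Delta}}{k-\sum_{t=1}^{v-2}N_t\brack n_{v-1}}_{q^2}\prod_{j=1}^{v-2}{n_j+2k-2\sum_{t=1}^{j}N_t+\min(\Delta,v-1-j)\brack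 n_j}_q$$ $$=\frac{(q^{2v(2v+1)},q^{(2v+1)(v-\Delta)},q^{(2v+1)(v+\Delta)};q^{2v(2v+1)})_\infty}{(q)_\infty}.$$ (1.9) For every integer $\Delta$ with $0\le\Delta<v$, $$\sum_{m,k,n_1,\dots,n_{v-1}\ge 0}\frac{q^{k^2+(m+k)^2+(m+2k)\Delta+\sum_{j=1}^{v-1}N_j^2}}{(q)_m(q)_{2k+\Delta}}{k-\sum_{t=1}^{v-2}N_t\brack n_{v-1}}_{q^2}\prod_{j=1}^{v-2}{n_j+2k-2\sum_{t=1}^{j}N_t+\min(\Delta,v-1-j)\brack n_j}_q$$ $$=\frac{(q^{2v(2v+1)},q^{v(2v+1-2\Delta)},q^{v(2v+1+2\Delta)};q^{2v(2v+1)})_\infty}{(q)_\infty}.$$ (4.22) $$\sum_{m,k,n_1,\dots,n_{v-1}\ge 0}\frac{q^{\binom{m+1}{2}+\binom{m+k+1}{2}+\sum_{j=1}^{v-1}N_j^2}}{(q)_m(q)_k}{\lfloor k/2\rfloor-\sum_{t=1}^{v-2}N_t\brack n_{v-1}}_{q^2}\prod_{j=1}^{v-2}{n_j+k-2\sum_{t=1}^{j}N_t\brack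 n_j}_q$$ $$=\frac{(q^{2v(2v+1)},q^{2v^2},q^{2v(v+1)};q^{2v(2v+1)})_\infty}{(q)_\infty}.$$ -/

import Mathlib

open Finset

noncomputable section

/-- The finite `q`-Pochhammer symbol `(a; q)_n = ∏_{j=0}^{n-1} (1 - a q^j)`. -/
def qPoch (a q : ℂ) (n : ℕ) : ℂ := ∏ j ∈ range n, (1 - a * q ^ j)

/-- The infinite `q`-Pochhammer symbol `(a; q)_∞ = ∏_{j ≥ 0} (1 - a q^j)`. -/
def qPochInf (a q : ℂ) : ℂ := ∏' j : ℕ, (1 - a * q ^ j)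

/-- For `|q| < 1` the infinite product defining `(a; q)_∞` converges. -/
theorem multipliable_qPochInf (a q : ℂ) (hq : ‖q‖ < 1) :
    Multipliable fun j : ℕ => 1 - a * q ^ j := by
  have h : Summable fun j : ℕ => ‖-(a * q ^ j)‖ := by
    simp only [norm_neg, norm_mul, norm_pow]
    exact (summable_geometric_of_lt_one (norm_nonneg q) hq).mul_left _
  simpa [sub_eq_add_neg] using multipliable_one_add_of_summable h

/-- The `q`-binomial coefficient with integer entries: writing `a = n + m`, `b = n`, it is
`(q;q)_{n+m} / ((q;q)_n (q;q)_m)` if `n, m ≥ 0`, and `0` otherwise. -/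
def qBinom (q : ℂ) (a b : ℤ) : ℂ :=
  if 0 ≤ b ∧ 0 ≤ a - b then
    qPoch q q a.toNat / (qPoch q q b.toNat * qPoch q q (a - b).toNat)
  else 0

/-- The entry `n_j`, `1 ≤ j ≤ r`, of a tuple `n = (n_1, …, n_r)` (and `0` for other `j`);
the entry `n_j` is stored at position `j - 1`. -/
def entry {r : ℕ} (n : Fin r → ℕ) (j : ℕ) : ℕ :=
  if h : 1 ≤ j ∧ j ≤ r then n ⟨j - 1, by omega⟩ else 0

/-- The tail sums `N_j = n_j + n_{j+1} + ⋯ + n_r` of a tuple `n = (n_1, …, n_r)`. -/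
def tailSum {r : ℕ} (n : Fin r → ℕ) (j : ℕ) : ℕ := ∑ i ∈ Icc j r, entry n i

end

/-!
The three multisums are evaluated by the Burge transform and two applications of Bailey's lemma.
Write `e(n) = 1 / (q; q)_n`, with `e(n) = 0` for `n < 0`.

*The inner sums.* For fixed `m` and `k` the sum over `n_1, …, n_{v-1}` is finite and equals
`∑_j (-1)^j q^(v j² + c j) [2k + Δ; k - v j]`, with `c = Δ` if the exponents `N_t` are present and
`c = 0` otherwise (`exists_hasSum_innerSummand`). To see this, the polynomial is refined by a second
parameter `M`, and it is shown that the refinement is a sum of products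
`(-1)^j q^(w j² + c j) [L + M + Δ + (w - 1) j; M - j] [L + M - (w - 1) j; M + j]`.
For `w = 1` this is the expansion of `[L + M; M]_{q²}` read off from
`(z; q)_n (-z; q)_n = (z²; q²)_n` (`hasSum_qBinom_sq`). The Burge transform, which is the
`q`-Pfaff–Saalschütz sum applied to each `j` (`hasSum_burge`), raises `w` by one and prepends one
summation variable. When `Δ` has its maximal value `w`, the formula for `w - 1` is used: passing from
`Δ = w - 1` to `Δ = w` by Pascal's rule changes the alternating sum by a family that is odd under
`j ↦ -1 - j` (`hasSum_burgeTerm_raise`, `hasSum_burgeTerm_raise_linear`). The limit `M → ∞` of the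
last transform is the `q`-Chu–Vandermonde sum.

*The outer sums.* With `M = m + k`, the sum over `k` and then over `M` of
`q^(M² + ΔM + k² + Δk) e(M - k) e(k - r) e(k + Δ + r)`, where `r = v j`, is
`q^(2 r² + 2 Δ r) / (q; q)_∞`: Bailey's lemma (`hasSum_bailey`) followed by the Durfee rectangle
identity (`hasSum_durfee`). For the triangular exponents the terms with `k` even and `k` odd
correspond to `Δ = 0` and `Δ = 1`, and only their total has a closed form
(`hasSum_triangular_bailey`).

*Conclusion.* All families are dominated by geometric series, so the sums over `j` and over `(m, k)`
may be interchanged (`HasSum.interchange`), and the remaining theta series in `j` is a product by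
the Jacobi triple product (`hasSum_triple_product`). For `q = 0` each multisum has the single nonzero
term `1`; it is treated separately so that integer powers of `q` are available elsewhere.
-/

/-! ### Reciprocal `q`-factorials and Pascal's rules -/

/-- The reciprocal `1 / (q; q)_n` for an integer `n`, read as `0` when `n < 0`. -/
noncomputable def qFactInv (q : ℂ) (n : ℤ) : ℂ := if 0 ≤ n then (qPoch q q n.toNat)⁻¹ else 0

theorem qFactInv_of_neg {q : ℂ} {n : ℤ} (h : n < 0) : qFactInv q n = 0 := by
  simp [qFactInv, not_le.mpr h]

theorem qFactInv_natCast (q : ℂ) (n : ℕ) : qFactInv q n = (qPoch q q n)⁻¹ := by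
  simp [qFactInv]

theorem qFactInv_zero (q : ℂ) : qFactInv q 0 = 1 := by simp [qFactInv, qPoch]

theorem qPoch_succ (a q : ℂ) (n : ℕ) : qPoch a q (n + 1) = qPoch a q n * (1 - a * q ^ n) :=
  prod_range_succ _ _

theorem one_sub_pow_ne_zero {q : ℂ} (hq : ‖q‖ < 1) {n : ℕ} (hn : n ≠ 0) : 1 - q ^ n ≠ 0 := by
  intro h
  have h1 : ‖q ^ n‖ = 1 := by rw [← sub_eq_zero.mp h]; simp
  rw [norm_pow] at h1
  exact (pow_lt_one₀ (norm_nonneg q) hq hn).ne h1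

theorem qPoch_self_ne_zero {q : ℂ} (hq : ‖q‖ < 1) (n : ℕ) : qPoch q q n ≠ 0 := by
  refine prod_ne_zero_iff.mpr fun j _ => ?_
  rw [← pow_succ']
  exact one_sub_pow_ne_zero hq (by omega)

theorem qBinom_eq (q : ℂ) (a b : ℤ) :
    qBinom q a b = qPoch q q a.toNat * qFactInv q b * qFactInv q (a - b) := by
  unfold qBinom qFactInv
  by_cases hb : 0 ≤ b <;> by_cases hab : 0 ≤ a - b <;>
    simp only [hb, hab, and_self, and_true, and_false, if_true, if_false, mul_zero, zero_mul]
  rw [div_eq_mul_inv, mul_inv, mul_assoc]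

theorem qBinom_of_neg {q : ℂ} {a b : ℤ} (h : b < 0) : qBinom q a b = 0 := by
  rw [qBinom, if_neg (by omega)]

theorem qBinom_of_lt {q : ℂ} {a b : ℤ} (h : a < b) : qBinom q a b = 0 := by
  rw [qBinom, if_neg (by omega)]

theorem qBinom_top_neg {q : ℂ} {a b : ℤ} (h : a < 0) : qBinom q a b = 0 := by
  rw [qBinom, if_neg (by omega)]

theorem qBinom_symm (q : ℂ) {a b c : ℤ} (h : b + c = a) : qBinom q a b = qBinom q a c := by
  rw [qBinom_eq, qBinom_eq, show a - b = c by omega, show a - c = b by omega]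
  ring

theorem qBinom_zero {q : ℂ} (hq : ‖q‖ < 1) {a : ℤ} (ha : 0 ≤ a) : qBinom q a 0 = 1 := by
  rw [qBinom_eq, qFactInv_zero, sub_zero, qFactInv, if_pos ha, mul_one,
    mul_inv_cancel₀ (qPoch_self_ne_zero hq _)]

theorem qBinom_zero_top (q : ℂ) {b : ℤ} (hb : b ≠ 0) : qBinom q 0 b = 0 := by
  rw [qBinom, if_neg (by omega)]

/-- The recursion of the reciprocal `q`-factorials, which holds for every integer `n`. -/
theorem qFactInv_sub_one {q : ℂ} (hq : ‖q‖ < 1) (n : ℤ) :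
    qFactInv q (n - 1) = (1 - q ^ n) * qFactInv q n := by
  rcases lt_trichotomy n 0 with h | rfl | h
  · rw [qFactInv_of_neg h, qFactInv_of_neg (by omega), mul_zero]
  · rw [qFactInv_of_neg (by omega), zpow_zero, sub_self, zero_mul]
  · obtain ⟨m, rfl⟩ : ∃ m : ℕ, n = m + 1 := ⟨(n - 1).toNat, by omega⟩
    rw [add_sub_cancel_right, qFactInv_natCast,
      show (m : ℤ) + 1 = ((m + 1 : ℕ) : ℤ) by push_cast; rfl, qFactInv_natCast,
      zpow_natCast, qPoch_succ, ← pow_succ', mul_inv]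
    field_simp [one_sub_pow_ne_zero hq (Nat.succ_ne_zero m)]

theorem qPoch_toNat (q : ℂ) {a : ℤ} (ha : 1 ≤ a) :
    qPoch q q a.toNat = qPoch q q (a - 1).toNat * (1 - q ^ a) := by
  obtain ⟨m, rfl⟩ : ∃ m : ℕ, a = m + 1 := ⟨(a - 1).toNat, by omega⟩
  rw [show ((m : ℤ) + 1).toNat = m + 1 by omega, show ((m : ℤ) + 1 - 1).toNat = m by omega,
    qPoch_succ, ← pow_succ', show (m : ℤ) + 1 = ((m + 1 : ℕ) : ℤ) by push_cast; rfl, zpow_natCast]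

/-- Pascal's rule; it fails only for `a = b = 0`. -/
theorem qBinom_pascal {q : ℂ} (h0 : q ≠ 0) (hq : ‖q‖ < 1) {a b : ℤ} (h : a ≠ 0 ∨ b ≠ 0) :
    qBinom q a b = qBinom q (a - 1) (b - 1) + q ^ b * qBinom q (a - 1) b := by
  rcases lt_trichotomy a 0 with ha | rfl | ha
  · rw [qBinom_top_neg ha, qBinom_top_neg (by omega), qBinom_top_neg (by omega)]; simp
  · rw [qBinom_zero_top q (by simpa using h), qBinom_top_neg (by omega),
      qBinom_top_neg (by omega)]; simp
  · rw [qBinom_eq q a, qBinom_eq q (a - 1), qBinom_eq q (a - 1), qPoch_toNat q ha,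
      qFactInv_sub_one hq b, show a - 1 - (b - 1) = a - b by ring,
      show a - 1 - b = a - b - 1 by ring, qFactInv_sub_one hq (a - b)]
    have : q ^ a = q ^ b * q ^ (a - b) := by rw [← zpow_add₀ h0]; congr 1; ring
    rw [this]; ring

/-- The mirror image of Pascal's rule; it fails only for `a = b = 0`. -/
theorem qBinom_pascal' {q : ℂ} (h0 : q ≠ 0) (hq : ‖q‖ < 1) {a b : ℤ} (h : a ≠ 0 ∨ b ≠ 0) :
    qBinom q a b = qBinom q (a - 1) b + q ^ (a - b) * qBinom q (a - 1) (b - 1) := by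
  rw [qBinom_symm q (show b + (a - b) = a by ring), qBinom_pascal h0 hq (by omega),
    qBinom_symm q (show b + (a - b - 1) = a - 1 by ring),
    qBinom_symm q (show (b - 1) + (a - b) = a - 1 by ring)]

/-! ### Summation formulas of Vandermonde and Saalschütz type -/

/-- The common form of the `q`-Vandermonde sums: a family `f A s` obeying Pascal's rule in `A` is
recovered from its initial values `f 0`. -/
theorem hasSum_qBinom_of_pascal {q : ℂ} (h0 : q ≠ 0) (hq : ‖q‖ < 1) (f : ℕ → ℤ → ℂ)
    (hf : ∀ A s, f (A + 1) s = f A s + q ^ ((A : ℤ) + 1 + s) * f A (s + 1)) (A : ℕ) (s : ℤ) :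
    HasSum (fun i : ℤ => q ^ (i * (i + s)) * qBinom q A i * f 0 (i + s)) (f A s) := by
  induction A generalizing s with
  | zero =>
    convert hasSum_single (0 : ℤ) ?_ using 1
    · simp [qBinom_zero hq]
    · intro i hi
      rw [Nat.cast_zero, qBinom_zero_top q hi]; simp
  | succ A ih =>
    rw [hf]
    have h2 := ((Equiv.addRight (-1 : ℤ)).hasSum_iff.mpr (ih (s + 1))).mul_left
      (q ^ ((A : ℤ) + 1 + s))
    convert (ih s).add h2 using 1
    funext i
    simp only [Function.comp_apply, Equiv.coe_addRight]
    rw [qBinom_pascal' h0 hq (by push_cast; omega),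
      show ((A + 1 : ℕ) : ℤ) - 1 = A by push_cast; ring, show i + -1 + (s + 1) = i + s by ring,
      ← sub_eq_add_neg]
    have : q ^ ((A : ℤ) + 1 + s) * q ^ ((i - 1) * (i + s)) =
        q ^ (i * (i + s)) * q ^ (((A + 1 : ℕ) : ℤ) - i) := by
      rw [← zpow_add₀ h0, ← zpow_add₀ h0]; congr 1; push_cast; ring
    linear_combination (-(qBinom q A (i - 1) * f 0 (i + s))) * this

theorem hasSum_qBinom_mul_qFactInv {q : ℂ} (h0 : q ≠ 0) (hq : ‖q‖ < 1) (A : ℕ) (s : ℤ) :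
    HasSum (fun i : ℤ => q ^ (i * (i + s)) * qBinom q A i * qFactInv q (i + s))
      (qFactInv q (A + s)) := by
  have := hasSum_qBinom_of_pascal h0 hq (fun A s => qFactInv q (A + s)) (fun A s => by
    have := qFactInv_sub_one hq ((A : ℤ) + 1 + s)
    rw [show (A : ℤ) + 1 + s - 1 = A + s by ring] at this
    push_cast
    rw [show (A : ℤ) + (s + 1) = A + 1 + s by ring, this]; ring) A s
  simpa using this

/-- The `q`-Chu–Vandermonde sum, in the parameters used throughout: the lower entries `i` and
`i + s` have a fixed difference. -/
theorem hasSum_qBinom_mul_qBinom {q : ℂ} (h0 : q ≠ 0) (hq : ‖q‖ < 1) (A B : ℕ) (s : ℤ) :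
    HasSum (fun i : ℤ => q ^ (i * (i + s)) * qBinom q A i * qBinom q B (i + s))
      (qBinom q (A + B) (A + s)) := by
  have := hasSum_qBinom_of_pascal h0 hq (fun A s => qBinom q (A + B) (A + s)) (fun A s => by
    push_cast
    rw [qBinom_pascal h0 hq (by omega)]
    rw [show (A : ℤ) + 1 + B - 1 = A + B by ring, show (A : ℤ) + 1 + s - 1 = A + s by ring,
      show (A : ℤ) + (s + 1) = A + 1 + s by ring]) A s
  simpa using this

/-- The `q`-Pfaff–Saalschütz sum in binomial form. Both sides satisfy the same recursion in `A` and
`m`, obtained by applying Pascal's rule twice. -/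
theorem hasSum_qSaalschutz {q : ℂ} (h0 : q ≠ 0) (hq : ‖q‖ < 1) (A B : ℕ) (m s : ℤ) :
    HasSum (fun i : ℤ => q ^ (i * (i + s)) * qBinom q A i * qBinom q B (i + s)
        * qBinom q (m - i + A + B) (m - i))
      (qBinom q (m + A + s) m * qBinom q (m + B) (m + s)) := by
  induction A generalizing m s with
  | zero =>
    convert hasSum_single (0 : ℤ) ?_ using 1
    · by_cases hs : s < 0
      · rw [qBinom_of_lt (by push_cast; omega), zero_add, qBinom_of_neg hs]; simp
      by_cases hm : m < 0
      · rw [qBinom_of_neg hm, qBinom_of_neg (b := m - 0) (by omega)]; simp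
      by_cases hB : (B : ℤ) < s
      · rw [qBinom_of_lt (a := m + B) (by omega), zero_add, qBinom_of_lt hB]; simp
      have e1 : qBinom q (m + (0 : ℕ) + s) m * qBinom q (m + B) (m + s)
          = qBinom q B s * qBinom q (m + B) m := by
        simp only [qBinom_eq]
        rw [show m + (0 : ℕ) + s - m = s by push_cast; ring, show m + B - (m + s) = B - s by ring,
          show m + B - m = (B : ℤ) by ring, show m + (0 : ℕ) + s = m + s by push_cast; ring]
        have a1 : qPoch q q (m + s).toNat * qFactInv q (m + s) = 1 := by
          rw [qFactInv, if_pos (by omega), mul_inv_cancel₀ (qPoch_self_ne_zero hq _)]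
        have a2 : qPoch q q (B : ℤ).toNat * qFactInv q B = 1 := by
          rw [qFactInv, if_pos (by omega), mul_inv_cancel₀ (qPoch_self_ne_zero hq _)]
        linear_combination qFactInv q m * qFactInv q s * qPoch q q (m + B).toNat
          * qFactInv q (B - s) * (a1 - a2)
      rw [e1]
      simp [qBinom_zero hq]
    · intro i hi
      rw [Nat.cast_zero, qBinom_zero_top q hi]; simp
  | succ A ihA =>
    have neg : ∀ m s : ℤ, m < 0 → HasSum (fun i : ℤ => q ^ (i * (i + s)) * qBinom q (A + 1 : ℕ) i
        * qBinom q B (i + s) * qBinom q (m - i + (A + 1 : ℕ) + B) (m - i))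
        (qBinom q (m + (A + 1 : ℕ) + s) m * qBinom q (m + B) (m + s)) := by
      intro m s hm
      rw [qBinom_of_neg hm, zero_mul]
      convert hasSum_zero with i
      by_cases hi : i < 0
      · rw [qBinom_of_neg hi]; simp
      · rw [qBinom_of_neg (b := m - i) (by omega)]; simp
    rcases lt_or_ge m 0 with hm | hm
    · exact neg m s hm
    lift m to ℕ using hm
    -- `S(A+1, m, s) = S(A+1, m-1, s) + q^m S(A, m, s) + q^(m+s) S(A, m-1, s+1)` for both sides
    have step : ∀ (n : ℕ) (s : ℤ), HasSum (fun i : ℤ => q ^ (i * (i + s)) * qBinom q (A + 1 : ℕ) i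
        * qBinom q B (i + s) * qBinom q ((n : ℤ) - 1 - i + (A + 1 : ℕ) + B) ((n : ℤ) - 1 - i))
        (qBinom q ((n : ℤ) - 1 + (A + 1 : ℕ) + s) ((n : ℤ) - 1)
          * qBinom q ((n : ℤ) - 1 + B) ((n : ℤ) - 1 + s)) →
        HasSum (fun i : ℤ => q ^ (i * (i + s)) * qBinom q (A + 1 : ℕ) i
        * qBinom q B (i + s) * qBinom q ((n : ℤ) - i + (A + 1 : ℕ) + B) ((n : ℤ) - i))
        (qBinom q ((n : ℤ) + (A + 1 : ℕ) + s) n * qBinom q ((n : ℤ) + B) ((n : ℤ) + s)) := by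
      intro n s h1
      have h2 := (ihA n s).mul_left (q ^ (n : ℤ))
      have h3 := ((Equiv.addRight (-1 : ℤ)).hasSum_iff.mpr (ihA ((n : ℤ) - 1) (s + 1))).mul_left
        (q ^ ((n : ℤ) + s))
      convert (h1.add h2).add h3 using 1
      · funext i
        simp only [Function.comp_apply, Equiv.coe_addRight]
        push_cast
        rw [qBinom_pascal h0 hq (a := (n : ℤ) - i + (A + 1) + B) (by omega),
          show (n : ℤ) - 1 - i + (A + 1) + B = n - i + A + B by ring,
          show (n : ℤ) - 1 - (i + -1) + A + B = n - i + A + B by ring,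
          show (n : ℤ) - i + (A + 1) + B - 1 = n - i + A + B by ring,
          show i + -1 + (s + 1) = i + s by ring, show (n : ℤ) - 1 - (i + -1) = n - i by ring,
          show (n : ℤ) - i - 1 = n - 1 - i by ring, ← sub_eq_add_neg]
        have e1 := qBinom_pascal h0 hq (a := (A : ℤ) + 1) (b := i) (by omega)
        rw [add_sub_cancel_right] at e1
        have e2 : q ^ (n : ℤ) = q ^ ((n : ℤ) - i) * q ^ i := by
          rw [← zpow_add₀ h0]; congr 1; ring
        have e3 : q ^ ((n : ℤ) + s) * q ^ ((i - 1) * (i + s)) =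
            q ^ ((n : ℤ) - i) * q ^ (i * (i + s)) := by
          rw [← zpow_add₀ h0, ← zpow_add₀ h0]; congr 1; ring
        linear_combination
          (q ^ (i * (i + s)) * qBinom q B (i + s) * q ^ ((n : ℤ) - i)
            * qBinom q (n - i + A + B) (n - i)) * e1
          - (q ^ (i * (i + s)) * qBinom q A i * qBinom q B (i + s)
            * qBinom q (n - i + A + B) (n - i)) * e2
          - (qBinom q A (i - 1) * qBinom q B (i + s) * qBinom q (n - i + A + B) (n - i)) * e3
      · push_cast
        rw [show (n : ℤ) - 1 + (A + 1) + s = n + A + s by ring,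
          show (n : ℤ) - 1 + A + (s + 1) = n + A + s by ring,
          show (n : ℤ) - 1 + B = n + B - 1 by ring, show (n : ℤ) - 1 + s = n + s - 1 by ring,
          show (n : ℤ) - 1 + (s + 1) = n + s by ring,
          show (n : ℤ) + (A + 1) + s = n + A + s + 1 by ring]
        -- `hx` and `hy` single out the exceptional cases of Pascal's rule
        by_cases hx : (n : ℤ) = 0 ∧ (A : ℤ) + s + 1 = 0
        · rw [hx.1, qBinom_of_neg (b := 0 + s) (by omega), qBinom_of_neg (b := 0 + s - 1) (by omega),
            qBinom_of_neg (b := (0 : ℤ) - 1) (by omega)]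
          ring
        have e1 := qBinom_pascal h0 hq (a := (n : ℤ) + A + s + 1) (b := n) (by omega)
        rw [add_sub_cancel_right] at e1
        by_cases hy : (n : ℤ) + B = 0 ∧ (n : ℤ) + s = 0
        · rw [e1, qBinom_of_neg (b := (n : ℤ) - 1) (by omega)]
          ring
        have e2 := qBinom_pascal h0 hq (a := (n : ℤ) + B) (b := n + s) (by omega)
        linear_combination qBinom q (n + B) (n + s) * e1 +
          qBinom q (n + A + s) (n - 1) * e2
    induction m generalizing s with
    | zero => exact step 0 s (neg _ s (by norm_num))
    | succ m ihm =>
      refine step (m + 1) s ?_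
      rw [show ((m + 1 : ℕ) : ℤ) - 1 = m by push_cast; ring]
      exact ihm s

theorem HasSum.of_eq {α : Type*} {f g : α → ℂ} {a b : ℂ} (h : HasSum f a) (hfg : ∀ x, g x = f x)
    (hab : b = a) : HasSum g b := by
  rw [hab, funext hfg]
  exact h

theorem summable_int_of_bounded {f : ℤ → ℂ} (a b : ℤ) (h : ∀ j, j < a ∨ b < j → f j = 0) :
    Summable f :=
  summable_of_ne_finset_zero (s := Finset.Icc a b) fun j hj => h j (by
    rw [Finset.mem_Icc] at hj; omega)

/-- Coefficient comparison in `(z; q)_n (-z; q)_n = (z²; q²)_n`. -/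
theorem hasSum_qBinom_sq (q : ℂ) (h0 : q ≠ 0) (hq : ‖q‖ < 1) (n : ℕ) (M : ℤ) :
    HasSum (fun j : ℤ => (-1) ^ j * q ^ (j * j) * qBinom q n (M - j) * qBinom q n (M + j))
      (qBinom (q ^ 2) n M) := by
  have h0' : q ^ 2 ≠ 0 := pow_ne_zero 2 h0
  have hq' : ‖q ^ 2‖ < 1 := by rw [norm_pow]; exact pow_lt_one₀ (norm_nonneg q) hq two_ne_zero
  induction n generalizing M with
  | zero =>
    convert hasSum_single (0 : ℤ) ?_ using 1
    · by_cases hM : M = 0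
      · subst hM; simp [qBinom_zero hq, qBinom_zero hq']
      · simp [qBinom_zero_top _ hM]
    · intro i hi
      rw [Nat.cast_zero]
      by_cases hM : M = i
      · rw [qBinom_zero_top q (b := M + i) (by omega), mul_zero]
      · rw [qBinom_zero_top q (b := M - i) (by omega)]; simp
  | succ n ih =>
    -- the two mixed products of Pascal's rule are `u j` and `-u (j - 1)`
    set u : ℤ → ℂ := fun j => (-1) ^ j * q ^ (j * j + j + n + 1 - M) * qBinom q n (M - j - 1) *
      qBinom q n (M + j) with hu
    obtain ⟨a, ha⟩ : Summable u := summable_int_of_bounded (-M) M fun j hj => by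
      rcases hj with hj | hj
      · simp only [hu]; rw [qBinom_of_neg (b := M + j) (by omega), mul_zero]
      · simp only [hu]; rw [qBinom_of_neg (b := M - j - 1) (by omega)]; simp
    have hu0 := ha.sub ((Equiv.addRight (-1 : ℤ)).hasSum_iff.mpr ha)
    rw [sub_self] at hu0
    convert ((ih M).add ((ih (M - 1)).mul_left (q ^ (2 * ((n : ℤ) + 1 - M))))).add hu0 using 1
    · funext j
      simp only [Function.comp_apply, Equiv.coe_addRight, hu]
      rw [qBinom_pascal' h0 hq (b := M - j) (by push_cast; omega),
        qBinom_pascal' h0 hq (b := M + j) (by push_cast; omega),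
        show ((n + 1 : ℕ) : ℤ) - 1 = n by push_cast; ring, ← sub_eq_add_neg,
        show M - (j - 1) - 1 = M - j by ring, show M - 1 - j = M - j - 1 by ring,
        show M - 1 + j = M + j - 1 by ring, show M + (j - 1) = M + j - 1 by ring,
        zpow_sub_one₀ (by norm_num : (-1 : ℂ) ≠ 0)]
      set c := (n : ℤ) + 1 - M with hc
      have e1 : q ^ (2 * c) = q ^ (c + j) * q ^ (c - j) := by
        rw [← zpow_add₀ h0]; congr 1; ring
      have e2 : q ^ (j * j + j + n + 1 - M) = q ^ (j * j) * q ^ (c + j) := by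
        rw [← zpow_add₀ h0]; congr 1; rw [hc]; ring
      have e3 : q ^ ((j - 1) * (j - 1) + (j - 1) + n + 1 - M) = q ^ (j * j) * q ^ (c - j) := by
        rw [← zpow_add₀ h0]; congr 1; rw [hc]; ring
      rw [e1, e2, e3, show ((n + 1 : ℕ) : ℤ) - (M - j) = c + j by rw [hc]; push_cast; ring,
        show ((n + 1 : ℕ) : ℤ) - (M + j) = c - j by rw [hc]; push_cast; ring]
      ring
    · rw [qBinom_pascal' h0' hq' (by push_cast; omega),
        show ((n + 1 : ℕ) : ℤ) - 1 = n by push_cast; ring, add_zero, zpow_mul]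
      norm_cast

/-! ### The Burge transform -/

/-- The `j`-th term of the alternating sum of products of two `q`-binomials on which the Burge
transform acts. -/
noncomputable def burgeTerm (q : ℂ) (w Δ c L M j : ℤ) : ℂ :=
  (-1) ^ j * q ^ (w * (j * j) + c * j) * qBinom q (L + M + Δ + (w - 1) * j) (M - j)
    * qBinom q (L + M - (w - 1) * j) (M + j)

theorem burgeTerm_of_bounds (q : ℂ) (w Δ c L : ℤ) {M j : ℤ} (h : j < -M ∨ M < j) :
    burgeTerm q w Δ c L M j = 0 := by
  rcases h with h | h
  · rw [burgeTerm, qBinom_of_neg (b := M + j) (by omega), mul_zero]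
  · rw [burgeTerm, qBinom_of_neg (b := M - j) (by omega), mul_zero, zero_mul]

theorem burgeTerm_of_neg (q : ℂ) {w Δ L : ℤ} (c M j : ℤ) (hw : 1 ≤ w) (hΔ : Δ ≤ w) (hL : L < 0) :
    burgeTerm q w Δ c L M j = 0 := by
  rcases le_or_gt 0 j with h | h
  · rw [burgeTerm, qBinom_of_lt (a := L + M - (w - 1) * j) (by nlinarith), mul_zero]
  · rw [burgeTerm, qBinom_of_lt (a := L + M + Δ + (w - 1) * j) (by nlinarith), mul_zero, zero_mul]

theorem hasSum_burgeTerm_one {q : ℂ} (h0 : q ≠ 0) (hq : ‖q‖ < 1) (L M : ℤ) :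
    HasSum (burgeTerm q 1 0 0 L M) (qBinom (q ^ 2) (L + M) M) := by
  rcases lt_or_ge (L + M) 0 with h | h
  · rw [qBinom_top_neg h]
    convert hasSum_zero with j
    rw [burgeTerm, qBinom_top_neg (a := L + M - (1 - 1) * j) (by omega), mul_zero]
  · obtain ⟨n, hn⟩ := Int.eq_ofNat_of_zero_le h
    convert hasSum_qBinom_sq q h0 hq n M using 1
    · funext j
      simp [burgeTerm, hn]
    · rw [hn]

/-- An alternating sum that is odd under the reflection `j ↦ -1 - j`. -/
theorem hasSum_reflection_odd (q : ℂ) (w t L M : ℤ) :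
    HasSum (fun j : ℤ => (-1) ^ j * q ^ (w * (j * (j + 1)) + t)
      * qBinom q (L + M + (w - 1) * (j + 1)) (M - j - 1)
      * qBinom q (L + M - (w - 1) * j) (M + j)) 0 := by
  set d : ℤ → ℂ := fun j => (-1) ^ j * q ^ (w * (j * (j + 1)) + t)
      * qBinom q (L + M + (w - 1) * (j + 1)) (M - j - 1)
      * qBinom q (L + M - (w - 1) * j) (M + j) with hd
  obtain ⟨a, ha⟩ : Summable d := summable_int_of_bounded (-M) M fun j hj => by
    rcases hj with hj | hj
    · simp only [hd]; rw [qBinom_of_neg (b := M + j) (by omega), mul_zero]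
    · simp only [hd]; rw [qBinom_of_neg (b := M - j - 1) (by omega)]; simp
  have h2 := (Equiv.subLeft (-1 : ℤ)).hasSum_iff.mpr ha
  have h3 : d ∘ Equiv.subLeft (-1 : ℤ) = fun j => -d j := by
    funext j
    simp only [Function.comp_apply, Equiv.subLeft_apply, hd]
    rw [show L + M + (w - 1) * (-1 - j + 1) = L + M - (w - 1) * j by ring,
      show L + M - (w - 1) * (-1 - j) = L + M + (w - 1) * (j + 1) by ring,
      show (-1 - j) * (-1 - j + 1) = j * (j + 1) by ring, show M - (-1 - j) - 1 = M + j by ring,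
      show M + (-1 - j) = M - j - 1 by ring, show -1 - j = -j - 1 by ring,
      zpow_sub_one₀ (by norm_num), zpow_neg, ← inv_zpow]
    norm_num
    ring
  rw [h3] at h2
  rwa [self_eq_neg.mp (h2.unique ha.neg)] at ha

/-- In the alternating sum the parameter `Δ = w - 1` may be replaced by `Δ = w`. -/
theorem hasSum_burgeTerm_raise {q : ℂ} (h0 : q ≠ 0) (hq : ‖q‖ < 1) {w : ℤ} (hw : 1 ≤ w) {L : ℤ}
    (M : ℕ) {S : ℂ} (h : HasSum (burgeTerm q w (w - 1) 0 L M) S) :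
    HasSum (burgeTerm q w w 0 L M) S := by
  rw [← add_zero S]
  convert h.add (hasSum_reflection_odd q w (L + w) L M) using 1
  funext j
  simp only [burgeTerm]
  -- where Pascal's rule fails, the second `q`-binomial vanishes
  by_cases hx : L + M + w + (w - 1) * j = 0 ∧ (M : ℤ) - j = 0
  · have hY : qBinom q (L + M - (w - 1) * j) (M + j) = 0 :=
      qBinom_top_neg (by nlinarith)
    rw [hY]; ring
  rw [qBinom_pascal' h0 hq (a := L + M + w + (w - 1) * j) (by omega),
    show L + M + w + (w - 1) * j - 1 = L + M + (w - 1) + (w - 1) * j by ring,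
    show L + M + (w - 1) * (j + 1) = L + M + (w - 1) + (w - 1) * j by ring]
  have : q ^ (w * (j * (j + 1)) + (L + w)) =
      q ^ (w * (j * j) + 0 * j) * q ^ (L + M + w + (w - 1) * j - (M - j)) := by
    rw [← zpow_add₀ h0]; congr 1; ring
  rw [this]
  ring

/-- The analogue of `hasSum_burgeTerm_raise` in the presence of linear exponents. -/
theorem hasSum_burgeTerm_raise_linear {q : ℂ} (h0 : q ≠ 0) (hq : ‖q‖ < 1) {w : ℤ} (hw : 1 ≤ w)
    {L : ℤ} (M : ℕ) {S : ℂ} (h : HasSum (burgeTerm q w (w - 1) (w - 1) L M) S) :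
    HasSum (burgeTerm q w w w L M) (q ^ (M : ℤ) * S) := by
  have h2 := (h.mul_left (q ^ (M : ℤ))).add (hasSum_reflection_odd q w 0 L M)
  rw [add_zero] at h2
  refine h2.of_eq (fun j => ?_) rfl
  simp only [burgeTerm]
  -- where Pascal's rule fails, the second `q`-binomial vanishes
  by_cases hx : L + M + w + (w - 1) * j = 0 ∧ (M : ℤ) - j = 0
  · have hY : qBinom q (L + M - (w - 1) * j) (M + j) = 0 :=
      qBinom_top_neg (by nlinarith)
    rw [hY]; ring
  rw [qBinom_pascal h0 hq (a := L + M + w + (w - 1) * j) (by omega),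
    show L + M + w + (w - 1) * j - 1 = L + M + (w - 1) + (w - 1) * j by ring,
    show L + M + (w - 1) * (j + 1) = L + M + (w - 1) + (w - 1) * j by ring]
  have e1 : q ^ (w * (j * (j + 1)) + 0) = q ^ (w * (j * j) + w * j) := by
    congr 1; ring
  have e2 : q ^ (w * (j * j) + w * j) * q ^ ((M : ℤ) - j) =
      q ^ (M : ℤ) * q ^ (w * (j * j) + (w - 1) * j) := by
    rw [← zpow_add₀ h0, ← zpow_add₀ h0]; congr 1; ring
  rw [e1]
  linear_combination ((-1) ^ j * qBinom q (L + M + (w - 1) + (w - 1) * j) (M - j)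
    * qBinom q (L + M - (w - 1) * j) (M + j)) * e2

theorem hasSum_nat_of_int {f : ℤ → ℂ} {a : ℂ} (h : HasSum f a) (hf : ∀ n < 0, f n = 0) :
    HasSum (fun n : ℕ => f n) a :=
  (Nat.cast_injective.hasSum_iff fun n hn => hf n (by
    by_contra hneg
    exact hn ⟨n.toNat, by omega⟩)).mpr h

/-- The upper entries of the two `q`-binomials depend only on the sum of the last two parameters. -/
theorem burgeTerm_sub (q : ℂ) (w Δ c L N j : ℤ) :
    burgeTerm q w Δ c (L - N) N j = (-1) ^ j * q ^ (w * (j * j) + c * j)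
      * qBinom q (L + Δ + (w - 1) * j) (N - j) * qBinom q (L - (w - 1) * j) (N + j) := by
  rw [burgeTerm]
  congr 3 <;> ring

/-- The Burge transform raises `w` by one. The condition `0 ≤ Δ ≤ w` makes both sides vanish for
negative `L`. -/
theorem hasSum_burge {q : ℂ} (h0 : q ≠ 0) (hq : ‖q‖ < 1) {w Δ : ℤ} (hw : 1 ≤ w) (hΔ0 : 0 ≤ Δ)
    (hΔ : Δ ≤ w) (c L M j : ℤ) :
    HasSum (fun N : ℕ => q ^ ((N : ℤ) * N) * qBinom q (M - N + 2 * L + Δ) (M - N)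
      * burgeTerm q w Δ c (L - N) N j) (burgeTerm q (w + 1) Δ c L M j) := by
  -- an upper entry `A` or `B` below zero makes both sides vanish
  by_cases hneg : L < 0 ∨ (j < 0 ∧ L + Δ + (w - 1) * j < 0) ∨ (0 ≤ j ∧ L - (w - 1) * j < 0)
  · have hz : burgeTerm q (w + 1) Δ c L M j = 0 := by
      rcases hneg with h | ⟨hj, h⟩ | ⟨hj, h⟩
      · exact burgeTerm_of_neg q c M j (by omega) (by omega) h
      · rw [burgeTerm, qBinom_of_lt (a := L + M + Δ + _) (by linarith), mul_zero, zero_mul]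
      · rw [burgeTerm, qBinom_of_lt (a := L + M - _) (by linarith), mul_zero]
    rw [hz]
    convert hasSum_zero with N
    rcases hneg with h | ⟨hj, h⟩ | ⟨hj, h⟩
    · rw [burgeTerm_of_neg q c N j hw hΔ (by omega), mul_zero]
    · rw [burgeTerm_sub, qBinom_top_neg h]; ring
    · rw [burgeTerm_sub, qBinom_top_neg h]; ring
  push Not at hneg
  obtain ⟨hL, hA, hB⟩ := hneg
  obtain ⟨A, hA⟩ := Int.eq_ofNat_of_zero_le (a := L + Δ + (w - 1) * j) (by
    by_cases hj : j < 0
    · exact hA hj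
    · nlinarith)
  obtain ⟨B, hB⟩ := Int.eq_ofNat_of_zero_le (a := L - (w - 1) * j) (by
    by_cases hj : j < 0
    · nlinarith
    · exact hB (by omega))
  have h1 := ((Equiv.addRight (-j)).hasSum_iff.mpr
    (hasSum_qSaalschutz h0 hq A B (M - j) (2 * j))).mul_left
      ((-1) ^ j * q ^ ((w + 1) * (j * j) + c * j))
  have h2 := hasSum_nat_of_int h1 fun N hN => by
    simp only [Function.comp_apply, Equiv.coe_addRight]
    by_cases hj : N + -j < 0
    · rw [qBinom_of_neg hj]; simp
    · rw [qBinom_of_neg (b := N + -j + 2 * j) (by omega)]; simp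
  convert h2 using 1
  · funext N
    rw [burgeTerm_sub, hA, hB]
    simp only [Function.comp_apply, Equiv.coe_addRight]
    rw [show (N : ℤ) + -j + 2 * j = N + j by ring, ← sub_eq_add_neg,
      show M - j - (N - j) = M - N by ring,
      show M - N + 2 * L + Δ = M - N + A + B by linarith]
    have : q ^ ((w + 1) * (j * j) + c * j) * q ^ (((N : ℤ) - j) * (N + j)) =
        q ^ ((N : ℤ) * N) * q ^ (w * (j * j) + c * j) := by
      rw [← zpow_add₀ h0, ← zpow_add₀ h0]; congr 1; ring
    linear_combination (-(-1) ^ j * qBinom q A (N - j) * qBinom q B (N + j)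
      * qBinom q (M - N + A + B) (M - N)) * this
  · rw [burgeTerm, show L + M + Δ + (w + 1 - 1) * j = M - j + A + 2 * j by rw [← hA]; ring,
      show L + M - (w + 1 - 1) * j = M - j + B by rw [← hB]; ring,
      show M - j + 2 * j = M + j by ring]
    ring

/-- The limiting case `M → ∞` of `hasSum_burge`, in which a single `q`-binomial remains. -/
theorem hasSum_burge_limit {q : ℂ} (h0 : q ≠ 0) (hq : ‖q‖ < 1) {w Δ : ℤ} (hw : 1 ≤ w)
    (hΔ0 : 0 ≤ Δ) (c : ℤ) {L : ℤ} (hL : 0 ≤ L) (j : ℤ) :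
    HasSum (fun N : ℕ => q ^ ((N : ℤ) * N) * burgeTerm q w Δ c (L - N) N j)
      ((-1) ^ j * q ^ ((w + 1) * (j * j) + c * j)
        * qBinom q (2 * L + Δ) (L - (w + 1) * j)) := by
  by_cases hneg : (j < 0 ∧ L + Δ + (w - 1) * j < 0) ∨ (0 ≤ j ∧ L - (w - 1) * j < 0)
  · have hz : qBinom q (2 * L + Δ) (L - (w + 1) * j) = 0 := by
      rcases hneg with ⟨hj, h⟩ | ⟨hj, h⟩
      · exact qBinom_of_lt (by linarith)
      · exact qBinom_of_neg (by linarith)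
    rw [hz, mul_zero]
    convert hasSum_zero with N
    rcases hneg with ⟨hj, h⟩ | ⟨hj, h⟩
    · rw [burgeTerm_sub, qBinom_top_neg h]; ring
    · rw [burgeTerm_sub, qBinom_top_neg h]; ring
  push Not at hneg
  obtain ⟨hA, hB⟩ := hneg
  obtain ⟨A, hA⟩ := Int.eq_ofNat_of_zero_le (a := L + Δ + (w - 1) * j) (by
    by_cases hj : j < 0
    · exact hA hj
    · nlinarith)
  obtain ⟨B, hB⟩ := Int.eq_ofNat_of_zero_le (a := L - (w - 1) * j) (by
    by_cases hj : j < 0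
    · nlinarith
    · exact hB (by omega))
  have h1 := ((Equiv.addRight (-j)).hasSum_iff.mpr
    (hasSum_qBinom_mul_qBinom h0 hq A B (2 * j))).mul_left
      ((-1) ^ j * q ^ ((w + 1) * (j * j) + c * j))
  have h2 := hasSum_nat_of_int h1 fun N hN => by
    simp only [Function.comp_apply, Equiv.coe_addRight]
    by_cases hj : N + -j < 0
    · rw [qBinom_of_neg hj]; simp
    · rw [qBinom_of_neg (b := N + -j + 2 * j) (by omega)]; simp
  convert h2 using 1
  · funext N
    rw [burgeTerm_sub, hA, hB]
    simp only [Function.comp_apply, Equiv.coe_addRight]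
    rw [show (N : ℤ) + -j + 2 * j = N + j by ring, ← sub_eq_add_neg]
    have : q ^ ((w + 1) * (j * j) + c * j) * q ^ (((N : ℤ) - j) * (N + j)) =
        q ^ ((N : ℤ) * N) * q ^ (w * (j * j) + c * j) := by
      rw [← zpow_add₀ h0, ← zpow_add₀ h0]; congr 1; ring
    linear_combination (-(-1) ^ j * qBinom q A (N - j) * qBinom q B (N + j)) * this
  · rw [qBinom_symm q (show (A : ℤ) + 2 * j + (L - (w + 1) * j) = A + B by
      rw [← hA, ← hB]; ring), show (A : ℤ) + B = 2 * L + Δ by rw [← hA, ← hB]; ring]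

/-! ### Iterating the Burge transform -/

/-- The converse of `HasSum.prod_fiberwise` for a function known to be summable. -/
theorem HasSum.of_rows {α β : Type*} {f : α × β → ℂ} {g : α → ℂ} {S : ℂ} (hf : Summable f)
    (hrow : ∀ a, HasSum (fun b => f (a, b)) (g a)) (hg : HasSum g S) : HasSum f S := by
  have h := hf.hasSum.prod_fiberwise hrow
  rw [hg.unique h]
  exact hf.hasSum

theorem HasSum.of_cols {α β : Type*} {f : α × β → ℂ} {g : β → ℂ} {S : ℂ} (hf : Summable f)
    (hcol : ∀ b, HasSum (fun a => f (a, b)) (g b)) (hg : HasSum g S) : HasSum f S := by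
  have h := HasSum.of_rows (f := f ∘ (Equiv.prodComm β α)) ((Equiv.prodComm β α).summable_iff.mpr hf)
    hcol hg
  exact (Equiv.prodComm β α).hasSum_iff.mp h

/-- The summand obtained by applying the Burge transform `r` times to `[L + M; M]_{q²}`; the
outermost transform has the summation variable `N_1 = n_1 + ⋯ + n_r`, the next one `N_2`, and so on
inwards. The innermost `Δ` transforms each raise the parameter `Δ` by one and carry the linear
exponents `ε N_i`. -/
noncomputable def burgeSummand (q : ℂ) (ε : ℕ) :
    (r : ℕ) → (Δ : ℕ) → (L M : ℤ) → (Fin r → ℕ) → ℂ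
  | 0, _, L, M, _ => qBinom (q ^ 2) (L + M) M
  | r + 1, Δ, L, M, n =>
    q ^ (((∑ i, n i : ℕ) : ℤ) * ((∑ i, n i : ℕ) : ℤ))
      * qBinom q (M - (∑ i, n i : ℕ) + 2 * L + Δ) (M - (∑ i, n i : ℕ))
      * (q ^ (if Δ = r + 1 then ε * ∑ i, n i else 0)
        * burgeSummand q ε r (min Δ r) (L - (∑ i, n i : ℕ)) (∑ i, n i : ℕ) (Fin.tail n))

theorem burgeSummand_of_neg (q : ℂ) (ε r Δ : ℕ) {L : ℤ} (M : ℤ) (n : Fin r → ℕ) (hL : L < 0) :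
    burgeSummand q ε r Δ L M n = 0 := by
  induction r generalizing Δ L M with
  | zero => exact qBinom_of_lt (by omega)
  | succ r ih =>
    rw [burgeSummand, ih _ _ _ (by omega), mul_zero, mul_zero]

theorem burgeSummand_of_lt (q : ℂ) (ε r Δ : ℕ) (L : ℤ) {M : ℤ} (n : Fin r → ℕ)
    (h : M < (∑ i, n i : ℕ)) : burgeSummand q ε r Δ L M n = 0 := by
  cases r with
  | zero => exact qBinom_of_neg (by simpa using h)
  | succ r => rw [burgeSummand, qBinom_of_neg (b := M - _) (by omega), mul_zero, zero_mul]

/-- A sum over pairs `(N, n')` with `N ≥ ∑ n'` is a sum over tuples `n`, where `n'` is the tail of `n`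
and `N` is the sum of all its entries. -/
theorem hasSum_tuple_of_hasSum_total {r : ℕ} {F : ℕ × (Fin r → ℕ) → ℂ} {S : ℂ}
    (h : HasSum F S) (hF : ∀ N n, N < ∑ i, n i → F (N, n) = 0) :
    HasSum (fun n : Fin (r + 1) → ℕ => F (∑ i, n i, Fin.tail n)) S := by
  have hinj : Function.Injective fun n : Fin (r + 1) → ℕ => (∑ i, n i, Fin.tail n) := by
    intro n n' hn
    obtain ⟨h1, h2⟩ := Prod.mk.inj hn
    rw [Fin.sum_univ_succ, Fin.sum_univ_succ] at h1
    have h3 : ∀ i : Fin r, n i.succ = n' i.succ := fun i => congrFun h2 i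
    simp only [h3] at h1
    funext i
    refine Fin.cases ?_ h3 i
    omega
  refine (hinj.hasSum_iff (f := F) fun x hx => ?_).mpr h
  obtain ⟨N, n⟩ := x
  refine hF N n ?_
  by_contra hlt
  refine hx ⟨Fin.cons (N - ∑ i, n i) n, ?_⟩
  simp only [Fin.sum_univ_succ, Fin.cons_zero, Fin.cons_succ, Fin.tail_cons]
  congr 1
  omega

/-- One Burge transform, with an arbitrary further weight `ω`, applied to two summations of the same
function: the multisum over `n` and the alternating sum over `j`. -/
theorem exists_hasSum_burgeSummand_step {q : ℂ} (h0 : q ≠ 0) (hq : ‖q‖ < 1) {ε : ℕ} (hε : ε ≤ 1)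
    {r Δ : ℕ} (hΔ : Δ ≤ r + 1) (L : ℤ) (ω : ℕ → ℂ) (R : ℤ → ℂ)
    (ih : ∀ (L : ℤ) (M : ℕ), ∃ S, HasSum (burgeSummand q ε r (min Δ r) L M) S ∧
      HasSum (burgeTerm q (r + 1) (min Δ r : ℕ) (ε * (min Δ r : ℕ)) L M) S)
    (hR : ∀ j, HasSum (fun N : ℕ => q ^ ((N : ℤ) * N) * ω N
      * burgeTerm q (r + 1) Δ (ε * Δ) (L - N) N j) (R j)) :
    ∃ S, HasSum (fun n : Fin (r + 1) → ℕ =>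
      q ^ (((∑ i, n i : ℕ) : ℤ) * ((∑ i, n i : ℕ) : ℤ)) * ω (∑ i, n i)
        * (q ^ (if Δ = r + 1 then ε * ∑ i, n i else 0) * burgeSummand q ε r (min Δ r)
          (L - (∑ i, n i : ℕ)) (∑ i, n i : ℕ) (Fin.tail n))) S ∧ HasSum R S := by
  -- the inner identity with `Δ` in place of `min Δ r`
  have key : ∀ N : ℕ, ∃ T, HasSum (fun n => q ^ (if Δ = r + 1 then ε * N else 0)
      * burgeSummand q ε r (min Δ r) (L - N) N n) T ∧
      HasSum (burgeTerm q (r + 1) Δ (ε * Δ) (L - N) N) T := by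
    intro N
    obtain ⟨T, hT1, hT2⟩ := ih (L - N) N
    by_cases hmax : Δ = r + 1
    · refine ⟨q ^ (ε * N) * T, by simpa [hmax] using hT1.mul_left (q ^ (ε * N)), ?_⟩
      subst hmax
      rw [min_eq_right (by omega)] at hT2
      have e : (r : ℤ) = (r : ℤ) + 1 - 1 := by ring
      interval_cases ε
      · have h := hasSum_burgeTerm_raise h0 hq (w := r + 1) (by omega) N (L := L - N) (S := T)
          (by simpa using hT2)
        simpa using h
      · have h := hasSum_burgeTerm_raise_linear h0 hq (w := r + 1) (by omega) N (L := L - N) (S := T)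
          (by simpa using hT2)
        simpa using h
    · rw [min_eq_left (by omega)] at hT1 hT2 ⊢
      exact ⟨T, by simpa [hmax] using hT1, hT2⟩
  choose T hT1 hT2 using key
  have hw : (1 : ℤ) ≤ r + 1 := by omega
  have hΔ' : (Δ : ℤ) ≤ r + 1 := by omega
  -- both double families vanish unless `0 ≤ N ≤ L`
  have hs1 : Summable fun x : ℕ × (Fin r → ℕ) => q ^ ((x.1 : ℤ) * x.1) * ω x.1
      * (q ^ (if Δ = r + 1 then ε * x.1 else 0)
        * burgeSummand q ε r (min Δ r) (L - x.1) x.1 x.2) := by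
    refine summable_of_ne_finset_zero
      (s := Finset.range (L.toNat + 1) ×ˢ Finset.Iic fun _ => L.toNat) ?_
    rintro ⟨N, n⟩ hx
    rw [Finset.mem_product, Finset.mem_range, Finset.mem_Iic, Pi.le_def] at hx
    by_cases hN : L < N
    · rw [burgeSummand_of_neg _ _ _ _ _ _ (by simpa using hN)]; simp
    · have : ∃ i, L.toNat < n i := by
        by_contra hcon; push Not at hcon; exact hx ⟨by simp only; omega, hcon⟩
      obtain ⟨i, hi⟩ := this
      have := Finset.single_le_sum (f := n) (fun _ _ => Nat.zero_le _) (Finset.mem_univ i)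
      rw [burgeSummand_of_lt _ _ _ _ _ _ (by simp only; omega)]; simp
  have hs2 : Summable fun x : ℕ × ℤ => q ^ ((x.1 : ℤ) * x.1) * ω x.1
      * burgeTerm q (r + 1) Δ (ε * Δ) (L - x.1) x.1 x.2 := by
    refine summable_of_ne_finset_zero
      (s := Finset.range (L.toNat + 1) ×ˢ Finset.Icc (-L) L) ?_
    rintro ⟨N, j⟩ hx
    rw [Finset.mem_product, Finset.mem_range, Finset.mem_Icc] at hx
    by_cases hN : L < N
    · rw [burgeTerm_of_neg q _ _ _ hw hΔ' (by simpa using hN)]; simp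
    · rw [burgeTerm_of_bounds _ _ _ _ _ (by simp only at hx ⊢; omega)]; simp
  have hrow1 := hs1.hasSum.prod_fiberwise fun N => (hT1 N).mul_left (q ^ ((N : ℤ) * N) * ω N)
  have hrow2 := HasSum.of_rows hs2 (fun N => (hT2 N).mul_left (q ^ ((N : ℤ) * N) * ω N)) hrow1
  refine ⟨_, hasSum_tuple_of_hasSum_total hs1.hasSum fun N n hN => ?_,
    ((Equiv.prodComm ℤ ℕ).hasSum_iff.mpr hrow2).prod_fiberwise hR⟩
  simp only
  rw [burgeSummand_of_lt _ _ _ _ _ _ (by exact_mod_cast hN)]; simp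

/-- The iterated Burge transform of `hasSum_burgeTerm_one`. -/
theorem exists_hasSum_burgeSummand {q : ℂ} (h0 : q ≠ 0) (hq : ‖q‖ < 1) {ε : ℕ} (hε : ε ≤ 1)
    (r : ℕ) {Δ : ℕ} (hΔ : Δ ≤ r) (L : ℤ) (M : ℕ) :
    ∃ S, HasSum (burgeSummand q ε r Δ L M) S ∧
      HasSum (burgeTerm q (r + 1) Δ (ε * Δ) L M) S := by
  induction r generalizing Δ L M with
  | zero =>
    obtain rfl : Δ = 0 := by omega
    refine ⟨_, ?_, by simpa using hasSum_burgeTerm_one h0 hq L M⟩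
    exact hasSum_unique _
  | succ r ih =>
    push_cast
    exact exists_hasSum_burgeSummand_step h0 hq hε hΔ L
      (fun N => qBinom q (M - N + 2 * L + Δ) (M - N)) _
      (fun L M => ih (by omega) L M)
      (fun j => hasSum_burge h0 hq (by omega) (by omega) (by omega) _ L M j)

/-- The polynomial identity behind the three multisums: the limit `M → ∞` of
`exists_hasSum_burgeSummand`. -/
theorem exists_hasSum_burgeSummand_limit {q : ℂ} (h0 : q ≠ 0) (hq : ‖q‖ < 1) {ε : ℕ} (hε : ε ≤ 1)
    (r : ℕ) {Δ : ℕ} (hΔ : Δ ≤ r + 1) (k : ℕ) :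
    ∃ S, HasSum (fun n : Fin (r + 1) → ℕ =>
      q ^ (((∑ i, n i : ℕ) : ℤ) * ((∑ i, n i : ℕ) : ℤ))
        * (q ^ (if Δ = r + 1 then ε * ∑ i, n i else 0) * burgeSummand q ε r (min Δ r)
          (k - (∑ i, n i : ℕ)) (∑ i, n i : ℕ) (Fin.tail n))) S ∧
      HasSum (fun j : ℤ => (-1) ^ j * q ^ (((r : ℤ) + 2) * (j * j) + ε * Δ * j)
        * qBinom q (2 * k + Δ) (k - (r + 2) * j)) S := by
  have := exists_hasSum_burgeSummand_step h0 hq hε hΔ k (fun _ => 1) _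
    (fun L M => exists_hasSum_burgeSummand h0 hq hε r (by omega) L M)
    (fun j => by
      simpa using hasSum_burge_limit h0 hq (w := r + 1) (Δ := Δ) (by omega) (by omega) (ε * Δ)
        (L := k) (by omega) j)
  simpa [add_assoc, one_add_one_eq_two] using this

/-! ### The explicit multisum -/

theorem entry_succ {r : ℕ} (n : Fin (r + 1) → ℕ) {j : ℕ} (hj : 1 ≤ j) :
    entry n (j + 1) = entry (Fin.tail n) j := by
  unfold entry
  by_cases h : j ≤ r
  · rw [dif_pos ⟨by omega, by omega⟩, dif_pos ⟨hj, h⟩, Fin.tail]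
    congr 1
    ext
    simp only [Fin.val_succ]
    omega
  · rw [dif_neg (by omega), dif_neg (by omega)]

theorem entry_one {r : ℕ} (n : Fin (r + 1) → ℕ) : entry n 1 = n 0 := by
  rw [entry, dif_pos ⟨le_rfl, by omega⟩]
  rfl

theorem sum_Icc_succ_succ {α : Type*} [AddCommMonoid α] (a b : ℕ) (f : ℕ → α) :
    ∑ t ∈ Icc (a + 1) (b + 1), f t = ∑ t ∈ Icc a b, f (t + 1) := by
  rw [← Finset.map_add_right_Icc, Finset.sum_map]
  rfl

theorem sum_Icc_one_succ {α : Type*} [AddCommMonoid α] (b : ℕ) (f : ℕ → α) :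
    ∑ t ∈ Icc 1 (b + 1), f t = f 1 + ∑ t ∈ Icc 1 b, f (t + 1) := by
  rw [← Finset.add_sum_Ioc_eq_sum_Icc (by omega), ← sum_Icc_succ_succ]
  rfl

theorem prod_Icc_one_succ {α : Type*} [CommMonoid α] (b : ℕ) (f : ℕ → α) :
    ∏ t ∈ Icc 1 (b + 1), f t = f 1 * ∏ t ∈ Icc 1 b, f (t + 1) :=
  sum_Icc_one_succ (α := Additive α) b f

theorem tailSum_succ {r : ℕ} (n : Fin (r + 1) → ℕ) {j : ℕ} (hj : 1 ≤ j) :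
    tailSum n (j + 1) = tailSum (Fin.tail n) j := by
  rw [tailSum, tailSum, sum_Icc_succ_succ]
  exact sum_congr rfl fun i hi => entry_succ n (by rw [mem_Icc] at hi; omega)

theorem tailSum_one {r : ℕ} (n : Fin r → ℕ) : tailSum n 1 = ∑ i, n i := by
  induction r with
  | zero => simp [tailSum]
  | succ r ih =>
    rw [Fin.sum_univ_succ, tailSum, sum_Icc_one_succ, entry_one]
    congr 1
    rw [← sum_Icc_succ_succ]
    exact (tailSum_succ n le_rfl).trans (ih _)

/-- The part of the summands that depends on `n = (n_1, …, n_{r+1})`, with `r + 2` in the place of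
`v`. The linear exponents `N_t` are present for `ε = 1` and absent for `ε = 0`. -/
noncomputable def innerSummand (q : ℂ) (ε r Δ : ℕ) (K : ℤ) (n : Fin (r + 1) → ℕ) : ℂ :=
  q ^ (∑ j ∈ Icc 1 (r + 1), tailSum n j ^ 2
      + ε * ∑ t ∈ Icc (r + 2 - Δ) (r + 1), tailSum n t)
    * qBinom (q ^ 2) (K - ∑ t ∈ Icc 1 r, (tailSum n t : ℤ)) (entry n (r + 1))
    * ∏ j ∈ Icc 1 r, qBinom q ((entry n j : ℤ) + 2 * K - 2 * ∑ t ∈ Icc 1 j, (tailSum n t : ℤ)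
      + min (Δ : ℤ) ((r : ℤ) + 1 - j)) (entry n j)

theorem sum_linear_exponents {r Δ : ℕ} (hΔ : Δ ≤ r + 2) (n : Fin (r + 2) → ℕ) :
    ∑ t ∈ Icc (r + 3 - Δ) (r + 2), tailSum n t = (if Δ = r + 2 then ∑ i, n i else 0)
      + ∑ t ∈ Icc (r + 2 - min Δ (r + 1)) (r + 1), tailSum (Fin.tail n) t := by
  have shift : ∀ a, 1 ≤ a → ∑ t ∈ Icc a (r + 1), tailSum n (t + 1)
      = ∑ t ∈ Icc a (r + 1), tailSum (Fin.tail n) t := fun a ha =>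
    sum_congr rfl fun t ht => tailSum_succ n (by rw [mem_Icc] at ht; omega)
  by_cases h : Δ = r + 2
  · subst h
    rw [if_pos rfl, show r + 3 - (r + 2) = 1 by omega,
      show r + 2 - min (r + 2) (r + 1) = 1 by omega, sum_Icc_one_succ, tailSum_one, shift 1 le_rfl]
  · rw [if_neg h, show r + 3 - Δ = r + 2 - Δ + 1 by omega, min_eq_left (by omega),
      sum_Icc_succ_succ, shift _ (by omega), zero_add]

theorem innerSummand_eq_burgeSummand (q : ℂ) (ε : ℕ) {r Δ : ℕ} (hΔ : Δ ≤ r + 1) (K : ℤ)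
    (n : Fin (r + 1) → ℕ) :
    innerSummand q ε r Δ K n = q ^ (((∑ i, n i : ℕ) : ℤ) * ((∑ i, n i : ℕ) : ℤ))
        * (q ^ (if Δ = r + 1 then ε * ∑ i, n i else 0) * burgeSummand q ε r (min Δ r)
          (K - (∑ i, n i : ℕ)) (∑ i, n i : ℕ) (Fin.tail n)) := by
  induction r generalizing Δ K with
  | zero =>
    have e0 : tailSum n 1 = n 0 := by rw [tailSum_one, Fin.sum_univ_one]
    rw [innerSummand, burgeSummand]
    simp only [zero_add, Icc_self, sum_singleton, e0, entry_one]
    interval_cases Δ <;> norm_cast <;>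
      simp [e0, pow_add, pow_two, mul_assoc, mul_comm, mul_left_comm]
  | succ r ih =>
    have hN : ∀ j ∈ Icc 1 (r + 1), tailSum n (j + 1) = tailSum (Fin.tail n) j :=
      fun j hj => tailSum_succ n (mem_Icc.mp hj).1
    have hN' : ∀ b, ∀ j ∈ Icc 1 b, (tailSum n (j + 1) : ℤ) = tailSum (Fin.tail n) j :=
      fun b j hj => by rw [tailSum_succ n (mem_Icc.mp hj).1]
    have hsum : ((∑ i, n i : ℕ) : ℤ) = n 0 + (∑ i, Fin.tail n i : ℕ) := by
      rw [Fin.sum_univ_succ]; push_cast; rfl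
    have h2 := ih (Δ := min Δ (r + 1)) (by omega) (K - (∑ i, n i : ℕ)) (Fin.tail n)
    rw [burgeSummand]
    rw [show q ^ (((∑ i, Fin.tail n i : ℕ) : ℤ) * ((∑ i, Fin.tail n i : ℕ) : ℤ))
      * qBinom q (((∑ i, n i : ℕ) : ℤ) - (∑ i, Fin.tail n i : ℕ) + 2 * (K - (∑ i, n i : ℕ))
        + (min Δ (r + 1) : ℕ)) (((∑ i, n i : ℕ) : ℤ) - (∑ i, Fin.tail n i : ℕ))
      * (q ^ (if min Δ (r + 1) = r + 1 then ε * ∑ i, Fin.tail n i else 0)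
        * burgeSummand q ε r (min (min Δ (r + 1)) r) (K - (∑ i, n i : ℕ)
          - (∑ i, Fin.tail n i : ℕ)) (∑ i, Fin.tail n i : ℕ) (Fin.tail (Fin.tail n)))
      = qBinom q (((∑ i, n i : ℕ) : ℤ) - (∑ i, Fin.tail n i : ℕ) + 2 * (K - (∑ i, n i : ℕ))
        + (min Δ (r + 1) : ℕ)) (((∑ i, n i : ℕ) : ℤ) - (∑ i, Fin.tail n i : ℕ))
        * innerSummand q ε r (min Δ (r + 1)) (K - (∑ i, n i : ℕ)) (Fin.tail n) by rw [h2]; ring]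
    rw [innerSummand, innerSummand, sum_linear_exponents hΔ, sum_Icc_one_succ (r + 1),
      sum_Icc_one_succ r (fun t => (tailSum n t : ℤ)), prod_Icc_one_succ,
      entry_succ n (by omega), tailSum_one,
      sum_congr rfl (hN' r), sum_congr rfl (fun j hj => by rw [hN j hj] :
        ∀ j ∈ Icc 1 (r + 1), tailSum n (j + 1) ^ 2 = tailSum (Fin.tail n) j ^ 2)]
    have hprod : ∏ j ∈ Icc 1 r, qBinom q ((entry n (j + 1) : ℤ) + 2 * K
        - 2 * ∑ t ∈ Icc 1 (j + 1), (tailSum n t : ℤ)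
        + min (Δ : ℤ) (((r + 1 : ℕ) : ℤ) + 1 - (j + 1 : ℕ))) (entry n (j + 1))
        = ∏ j ∈ Icc 1 r, qBinom q ((entry (Fin.tail n) j : ℤ) + 2 * (K - (∑ i, n i : ℕ))
          - 2 * ∑ t ∈ Icc 1 j, (tailSum (Fin.tail n) t : ℤ)
          + min ((min Δ (r + 1) : ℕ) : ℤ) ((r : ℤ) + 1 - j)) (entry (Fin.tail n) j) := by
      refine prod_congr rfl fun j hj => ?_
      rw [mem_Icc] at hj
      rw [entry_succ n hj.1, sum_Icc_one_succ, sum_congr rfl (hN' j), tailSum_one]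
      congr 1
      rw [show min (Δ : ℤ) (((r + 1 : ℕ) : ℤ) + 1 - (j + 1 : ℕ))
        = min ((min Δ (r + 1) : ℕ) : ℤ) ((r : ℤ) + 1 - j) by push_cast; omega]
      ring
    rw [hprod]
    have hfirst : qBinom q ((entry n 1 : ℤ) + 2 * K - 2 * ∑ t ∈ Icc 1 1, (tailSum n t : ℤ)
        + min (Δ : ℤ) (((r + 1 : ℕ) : ℤ) + 1 - (1 : ℕ))) (entry n 1)
        = qBinom q (((∑ i, n i : ℕ) : ℤ) - (∑ i, Fin.tail n i : ℕ) + 2 * (K - (∑ i, n i : ℕ))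
        + (min Δ (r + 1) : ℕ)) (((∑ i, n i : ℕ) : ℤ) - (∑ i, Fin.tail n i : ℕ)) := by
      rw [Icc_self, sum_singleton, tailSum_one, entry_one,
        show ((∑ i, n i : ℕ) : ℤ) - (∑ i, Fin.tail n i : ℕ) = n 0 by rw [hsum]; ring]
      congr 1
      push_cast
      rw [add_sub_cancel_right]
      ring
    rw [hfirst, ← sub_sub]
    have hpow : q ^ ((∑ i, n i) ^ 2 + ∑ j ∈ Icc 1 (r + 1), tailSum (Fin.tail n) j ^ 2
        + ε * ((if Δ = r + 2 then ∑ i, n i else 0)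
          + ∑ t ∈ Icc (r + 2 - min Δ (r + 1)) (r + 1), tailSum (Fin.tail n) t))
        = q ^ (((∑ i, n i : ℕ) : ℤ) * ((∑ i, n i : ℕ) : ℤ))
          * q ^ (if Δ = r + 1 + 1 then ε * ∑ i, n i else 0)
          * q ^ (∑ j ∈ Icc 1 (r + 1), tailSum (Fin.tail n) j ^ 2
            + ε * ∑ t ∈ Icc (r + 2 - min Δ (r + 1)) (r + 1), tailSum (Fin.tail n) t) := by
      rw [← Nat.cast_mul, zpow_natCast, ← pow_add, ← pow_add]
      congr 1
      split_ifs <;> ring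
    rw [hpow]
    ring

/-! ### Bounds and summability -/

theorem qPochInf_self_ne_zero {q : ℂ} (hq : ‖q‖ < 1) : qPochInf q q ≠ 0 := by
  have h := tprod_one_add_ne_zero_of_summable (f := fun j : ℕ => -(q * q ^ j)) (fun j => by
    rw [← sub_eq_add_neg, ← pow_succ']
    exact one_sub_pow_ne_zero hq (Nat.succ_ne_zero j)) (by
      simp only [norm_neg, norm_mul, norm_pow]
      exact (summable_geometric_of_lt_one (norm_nonneg q) hq).mul_left _)
  simpa [qPochInf, sub_eq_add_neg] using h

theorem tendsto_qPoch (a : ℂ) {q : ℂ} (hq : ‖q‖ < 1) :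
    Filter.Tendsto (qPoch a q) Filter.atTop (nhds (qPochInf a q)) :=
  (multipliable_qPochInf a q hq).hasProd.tendsto_prod_nat

theorem exists_norm_le_of_tendsto {u : ℕ → ℂ} {x : ℂ} (h : Filter.Tendsto u Filter.atTop (nhds x)) :
    ∃ C : ℝ, ∀ n, ‖u n‖ ≤ C := by
  obtain ⟨C, hC⟩ := (Metric.isBounded_range_of_tendsto u h).exists_norm_le
  exact ⟨C, fun n => hC _ ⟨n, rfl⟩⟩

theorem exists_norm_qFactInv_le {q : ℂ} (hq : ‖q‖ < 1) :
    ∃ C : ℝ, 1 ≤ C ∧ ∀ n, ‖qFactInv q n‖ ≤ C := by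
  obtain ⟨C, hC⟩ := exists_norm_le_of_tendsto ((tendsto_qPoch q hq).inv₀ (qPochInf_self_ne_zero hq))
  refine ⟨max C 1, le_max_right _ _, fun n => ?_⟩
  rcases lt_or_ge n 0 with h | h
  · rw [qFactInv_of_neg h, norm_zero]
    exact zero_le_one.trans (le_max_right _ _)
  · rw [qFactInv, if_pos h]
    exact (hC _).trans (le_max_left _ _)

theorem exists_norm_qBinom_le {q : ℂ} (hq : ‖q‖ < 1) :
    ∃ C : ℝ, 1 ≤ C ∧ ∀ a b, ‖qBinom q a b‖ ≤ C := by
  obtain ⟨C, hC1, hC⟩ := exists_norm_qFactInv_le hq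
  obtain ⟨D, hD⟩ := exists_norm_le_of_tendsto (tendsto_qPoch q hq)
  have hD0 : 0 ≤ D := (norm_nonneg _).trans (hD 0)
  refine ⟨max (D * C * C) 1, le_max_right _ _, fun a b => le_trans ?_ (le_max_left _ _)⟩
  rw [qBinom_eq, norm_mul, norm_mul]
  gcongr
  exacts [hD _, hC _, hC _]

theorem summable_zpow_abs {ρ : ℝ} (h0 : 0 < ρ) (h1 : ρ < 1) : Summable fun j : ℤ => ρ ^ |j| := by
  have h := summable_geometric_of_lt_one h0.le h1
  rw [summable_int_iff_summable_nat_and_neg]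
  constructor <;> simpa using h

theorem summable_pow_sum {ρ : ℝ} (h0 : 0 ≤ ρ) (h1 : ρ < 1) (r : ℕ) :
    Summable fun n : Fin r → ℕ => ρ ^ ∑ i, n i := by
  induction r with
  | zero => exact Summable.of_finite
  | succ r ih =>
    rw [← (Fin.consEquiv fun _ : Fin (r + 1) => ℕ).summable_iff]
    refine ((summable_geometric_of_lt_one h0 h1).mul_of_nonneg ih (fun _ => pow_nonneg h0 _)
      fun _ => pow_nonneg h0 _).congr fun x => ?_
    simp [Fin.consEquiv, Fin.sum_univ_succ, pow_add]

theorem norm_zpow_le {q : ℂ} (h0 : q ≠ 0) (hq : ‖q‖ < 1) {m n : ℤ} (h : m ≤ n) :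
    ‖q ^ n‖ ≤ ‖q‖ ^ m := by
  rw [norm_zpow]
  exact zpow_le_zpow_right_of_le_one₀ (norm_pos_iff.mpr h0) hq.le h

/-! ### Two infinite sums -/

theorem tendsto_qFactInv {q : ℂ} (hq : ‖q‖ < 1) (c : ℤ) :
    Filter.Tendsto (fun A : ℕ => qFactInv q (A + c)) Filter.atTop (nhds (qPochInf q q)⁻¹) := by
  have h : Filter.Tendsto (fun A : ℕ => ((A : ℤ) + c).toNat) Filter.atTop Filter.atTop := by
    refine Filter.tendsto_atTop.mpr fun b => ?_
    filter_upwards [Filter.eventually_ge_atTop (b + c.natAbs)] with A hA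
    omega
  refine (((tendsto_qPoch q hq).inv₀ (qPochInf_self_ne_zero hq)).comp h).congr' ?_
  filter_upwards [Filter.eventually_ge_atTop c.natAbs] with A hA
  rw [Function.comp_apply, qFactInv, if_pos (by omega)]

theorem tendsto_qPoch_toNat {q : ℂ} (hq : ‖q‖ < 1) :
    Filter.Tendsto (fun A : ℕ => qPoch q q (A : ℤ).toNat) Filter.atTop (nhds (qPochInf q q)) := by
  simpa using tendsto_qPoch q hq

/-- The Durfee rectangle identity. -/
theorem hasSum_durfee {q : ℂ} (h0 : q ≠ 0) (hq : ‖q‖ < 1) (s : ℤ) :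
    HasSum (fun i : ℤ => q ^ (i * (i + s)) * qFactInv q i * qFactInv q (i + s))
      (qPochInf q q)⁻¹ := by
  obtain ⟨C, hC1, hC⟩ := exists_norm_qFactInv_le hq
  obtain ⟨D, hD1, hD⟩ := exists_norm_qBinom_le hq
  have hbound : Summable fun i : ℤ => ‖q‖ ^ (|i| - |s|) * D * C := by
    have := (summable_zpow_abs (norm_pos_iff.mpr h0) hq).mul_right (‖q‖ ^ (-|s|) * D * C)
    refine this.congr fun i => ?_
    rw [sub_eq_add_neg, zpow_add₀ (norm_ne_zero_iff.mpr h0)]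
    ring
  have hexp : ∀ i : ℤ, 0 ≤ i → 0 ≤ i + s → |i| - |s| ≤ i * (i + s) := by
    intro i h1 h2
    rw [abs_of_nonneg h1]
    rcases h1.eq_or_lt with rfl | h1
    · simp
    rcases h2.eq_or_lt with h2 | h2
    · rw [← h2]
      have := neg_le_abs s
      omega
    · have := abs_nonneg s
      nlinarith
  -- the finite sum is dominated by a geometric series, uniformly in `A`
  have hle : ∀ (i : ℤ) (x : ℂ), (i < 0 → x = 0) → ‖x‖ ≤ D →
      ‖q ^ (i * (i + s)) * x * qFactInv q (i + s)‖ ≤ ‖q‖ ^ (|i| - |s|) * D * C := by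
    intro i x hx hxD
    by_cases hi : i < 0
    · rw [hx hi]; simp; positivity
    by_cases his : i + s < 0
    · rw [qFactInv_of_neg his]; simp; positivity
    rw [norm_mul, norm_mul]
    gcongr
    exacts [norm_zpow_le h0 hq (hexp i (by omega) (by omega)), hC _]
  have hlim : ∀ i : ℤ, Filter.Tendsto
      (fun A : ℕ => q ^ (i * (i + s)) * qBinom q A i * qFactInv q (i + s)) Filter.atTop
      (nhds (q ^ (i * (i + s)) * qFactInv q i * qFactInv q (i + s))) := by
    intro i
    refine Filter.Tendsto.mul_const _ (Filter.Tendsto.const_mul _ ?_)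
    have := ((tendsto_qPoch_toNat hq).mul_const (qFactInv q i)).mul (tendsto_qFactInv hq (-i))
    rw [mul_right_comm, mul_inv_cancel₀ (qPochInf_self_ne_zero hq), one_mul] at this
    refine this.congr fun A => ?_
    rw [qBinom_eq, sub_eq_add_neg]
  have htends := tendsto_tsum_of_dominated_convergence hbound hlim
    (Filter.Eventually.of_forall fun A i => hle i _ (fun hi => qBinom_of_neg hi) (hD _ _))
  have hsum : Summable fun i : ℤ => q ^ (i * (i + s)) * qFactInv q i * qFactInv q (i + s) := by
    refine Summable.of_norm_bounded hbound fun i => ?_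
    exact le_of_tendsto (hlim i).norm (Filter.Eventually.of_forall fun A =>
      hle i _ (fun hi => qBinom_of_neg hi) (hD _ _))
  simp_rw [(hasSum_qBinom_mul_qFactInv h0 hq _ s).tsum_eq] at htends
  rw [← tendsto_nhds_unique htends (tendsto_qFactInv hq s)]
  exact hsum.hasSum

/-- The finite form of the Jacobi triple product, with `P = y z`. -/
theorem hasSum_finite_triple_product {P y z : ℂ} (hP0 : P ≠ 0) (hP : ‖P‖ < 1) (h : y * z = P)
    (n : ℕ) :
    HasSum (fun j : ℤ => (-1) ^ j * P ^ (j * (j - 1) / 2) * z ^ j * qBinom P (2 * n) (n + j))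
      (qPoch y P n * qPoch z P n) := by
  have hz : z ≠ 0 := by rintro rfl; simp at h; exact hP0 h.symm
  induction n with
  | zero =>
    convert hasSum_single (0 : ℤ) ?_ using 1
    · simp [qBinom_zero hP, qPoch]
    · intro j hj
      rw [Nat.cast_zero, mul_zero, zero_add, qBinom_zero_top P hj, mul_zero]
  | succ n ih =>
    have hup := ((Equiv.addRight (-1 : ℤ)).hasSum_iff.mpr ih).mul_left (-(z * P ^ n))
    have hdown := ((Equiv.addRight (1 : ℤ)).hasSum_iff.mpr ih).mul_left (-(y * P ^ n))
    have hall := ((ih.mul_left (1 + P ^ (2 * n + 1))).add hup).add hdown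
    rw [qPoch_succ, qPoch_succ]
    refine hall.of_eq (fun j => ?_) ?_
    · simp only [Function.comp_apply, Equiv.coe_addRight]
      have hn : ((n + 1 : ℕ) : ℤ) = n + 1 := by push_cast; rfl
      have p1 := qBinom_pascal hP0 hP (a := 2 * ((n : ℤ) + 1)) (b := n + 1 + j) (by omega)
      have p2 := qBinom_pascal' hP0 hP (a := 2 * (n : ℤ) + 1) (b := n + j) (by omega)
      have p3 := qBinom_pascal' hP0 hP (a := 2 * (n : ℤ) + 1) (b := n + 1 + j) (by omega)
      rw [show 2 * ((n : ℤ) + 1) - 1 = 2 * n + 1 by ring,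
        show (n : ℤ) + 1 + j - 1 = n + j by ring] at p1
      rw [add_sub_cancel_right] at p2 p3
      rw [show (n : ℤ) + 1 + j - 1 = n + j by ring] at p3
      have t1 : (j + -1) * (j + -1 - 1) / 2 = j * (j - 1) / 2 - (j - 1) := by
        rw [show (j + -1) * (j + -1 - 1) = j * (j - 1) + (-(j - 1)) * 2 by ring,
          Int.add_mul_ediv_right _ _ (by norm_num)]
        ring
      have t2 : (j + 1) * (j + 1 - 1) / 2 = j * (j - 1) / 2 + j := by
        rw [show (j + 1) * (j + 1 - 1) = j * (j - 1) + j * 2 by ring,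
          Int.add_mul_ediv_right _ _ (by norm_num)]
      have e1 : P ^ n * P ^ (j * (j - 1) / 2 - (j - 1))
          = P ^ (j * (j - 1) / 2) * P ^ (2 * (n : ℤ) + 1 - (n + j)) := by
        rw [← zpow_natCast, ← zpow_add₀ hP0, ← zpow_add₀ hP0]; congr 1; ring
      have e2 : P * P ^ n * P ^ (j * (j - 1) / 2 + j)
          = P ^ (j * (j - 1) / 2) * P ^ ((n : ℤ) + 1 + j) := by
        rw [← zpow_natCast, ← zpow_one_add₀ hP0, ← zpow_add₀ hP0, ← zpow_add₀ hP0]; congr 1; ring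
      have e3 : P ^ (2 * n + 1) = P ^ ((n : ℤ) + 1 + j) * P ^ (2 * (n : ℤ) + 1 - (n + 1 + j)) := by
        rw [← zpow_natCast, ← zpow_add₀ hP0]; congr 1; push_cast; ring
      have z1 : z * z ^ (j + -1) = z ^ j := by
        rw [← zpow_one_add₀ hz]; congr 1; ring
      have z2 : y * z ^ (j + 1) = P * z ^ j := by
        rw [zpow_add_one₀ hz, ← h]; ring
      have s1 : (-1 : ℂ) ^ (j + -1) = -(-1) ^ j := by
        rw [← sub_eq_add_neg, zpow_sub_one₀ (by norm_num)]; ring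
      have s2 : (-1 : ℂ) ^ (j + 1) = -(-1) ^ j := by
        rw [zpow_add_one₀ (by norm_num)]; ring
      rw [hn, p1, p2, p3, t1, t2, s1, s2, e3, show (n : ℤ) + (j + -1) = n + j - 1 by ring,
        show (n : ℤ) + (j + 1) = n + 1 + j by ring]
      linear_combination
        (-(-1) ^ j * z ^ j * qBinom P (2 * n) (n + j - 1)) * e1
        - ((-1) ^ j * z ^ j * qBinom P (2 * n) (n + 1 + j)) * e2
        - ((-1) ^ j * P ^ n * P ^ (j * (j - 1) / 2 - (j - 1)) * qBinom P (2 * n) (n + j - 1)) * z1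
        - ((-1) ^ j * P ^ n * P ^ (j * (j - 1) / 2 + j) * qBinom P (2 * n) (n + 1 + j)) * z2
    · have : P ^ (2 * n + 1) = y * z * (P ^ n * P ^ n) := by rw [h]; ring
      rw [this]; ring

/-- The Jacobi triple product for positive powers of `q`. -/
theorem hasSum_triple_product {q : ℂ} (h0 : q ≠ 0) (hq : ‖q‖ < 1) {α β : ℕ} (hα : 0 < α)
    (hβ : 0 < β) :
    HasSum (fun j : ℤ => (-1) ^ j * q ^ ((α : ℤ) * (j * (j - 1) / 2) + β * (j * (j - 1) / 2 + j)))
      (qPochInf (q ^ (α + β)) (q ^ (α + β)) * qPochInf (q ^ α) (q ^ (α + β))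
        * qPochInf (q ^ β) (q ^ (α + β))) := by
  set P := q ^ (α + β) with hPdef
  have hP0 : P ≠ 0 := pow_ne_zero _ h0
  have hP : ‖P‖ < 1 := by rw [hPdef, norm_pow]; exact pow_lt_one₀ (norm_nonneg q) hq (by omega)
  obtain ⟨D, hD1, hD⟩ := exists_norm_qBinom_le hP
  have hterm : ∀ j : ℤ, P ^ (j * (j - 1) / 2) * (q ^ β) ^ j
      = q ^ ((α : ℤ) * (j * (j - 1) / 2) + β * (j * (j - 1) / 2 + j)) := by
    intro j
    rw [hPdef, ← zpow_natCast, ← zpow_natCast, ← zpow_mul, ← zpow_mul, ← zpow_add₀ h0]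
    congr 1; push_cast; ring
  have hexp : ∀ j : ℤ, |j| ≤ (α : ℤ) * (j * (j - 1) / 2) + β * (j * (j - 1) / 2 + j) := by
    intro j
    have h2 : j * (j - 1) / 2 * 2 = j * (j - 1) := Int.ediv_mul_cancel (by
      rw [mul_comm]; exact (Int.even_mul_pred_self j).two_dvd |> fun h => by rwa [mul_comm] at h)
    set t := j * (j - 1) / 2
    have ht1 : 0 ≤ t := by nlinarith [mul_self_nonneg (2 * j - 1)]
    have ht2 : 0 ≤ t + j := by nlinarith [mul_self_nonneg (2 * j + 1)]
    have h3 : |j| ≤ t + (t + j) := by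
      rw [abs_le]; constructor <;> nlinarith [mul_self_nonneg (2 * j + 1), mul_self_nonneg (2 * j - 1)]
    have h4 : t ≤ α * t := by nlinarith
    have h5 : t + j ≤ β * (t + j) := by nlinarith
    linarith
  have hbound := (summable_zpow_abs (norm_pos_iff.mpr h0) hq).mul_right D
  have hle : ∀ (j : ℤ) (n : ℕ), ‖(-1) ^ j * P ^ (j * (j - 1) / 2) * (q ^ β) ^ j
      * qBinom P (2 * n) (n + j)‖ ≤ ‖q‖ ^ |j| * D := by
    intro j n
    rw [mul_assoc ((-1) ^ j), hterm, norm_mul, norm_mul]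
    gcongr
    · simpa using norm_zpow_le h0 hq (hexp j)
    · exact hD _ _
  have hlim : ∀ j : ℤ, Filter.Tendsto (fun n : ℕ => (-1) ^ j * P ^ (j * (j - 1) / 2) * (q ^ β) ^ j
      * qBinom P (2 * n) (n + j)) Filter.atTop
      (nhds ((-1) ^ j * P ^ (j * (j - 1) / 2) * (q ^ β) ^ j * (qPochInf P P)⁻¹)) := by
    intro j
    refine Filter.Tendsto.const_mul _ ?_
    have h2 : Filter.Tendsto (fun n : ℕ => qPoch P P (2 * (n : ℤ)).toNat) Filter.atTop
        (nhds (qPochInf P P)) :=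
      ((tendsto_qPoch P hP).comp (Filter.tendsto_id.const_mul_atTop' (two_pos))).congr fun n => by
        simp only [Function.comp_apply, id]
        congr 1
    have := (h2.mul (tendsto_qFactInv hP j)).mul (tendsto_qFactInv hP (-j))
    rw [mul_inv_cancel₀ (qPochInf_self_ne_zero hP), one_mul] at this
    refine this.congr fun n => ?_
    rw [qBinom_eq, show 2 * (n : ℤ) - (n + j) = n + -j by ring]
  have htends := tendsto_tsum_of_dominated_convergence hbound hlim
    (Filter.Eventually.of_forall fun n j => hle j n)
  have hsum : Summable fun j : ℤ =>
      (-1) ^ j * P ^ (j * (j - 1) / 2) * (q ^ β) ^ j * (qPochInf P P)⁻¹ :=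
    Summable.of_norm_bounded hbound fun j =>
      le_of_tendsto (hlim j).norm (Filter.Eventually.of_forall fun n => hle j n)
  simp_rw [(hasSum_finite_triple_product hP0 hP (show q ^ α * q ^ β = P from (pow_add q α β).symm)
    _).tsum_eq] at htends
  have hval := tendsto_nhds_unique htends ((tendsto_qPoch (q ^ α) hP).mul (tendsto_qPoch (q ^ β) hP))
  have hfin := hsum.hasSum.mul_right (qPochInf P P)
  rw [hval] at hfin
  refine hfin.of_eq (fun j => ?_) ?_
  · rw [inv_mul_cancel_right₀ (qPochInf_self_ne_zero hP), mul_assoc, hterm]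
  · ring

/-! ### Bailey-type summations over `m` and `k` -/

theorem hasSum_qFactInv_vandermonde {q : ℂ} (h0 : q ≠ 0) (hq : ‖q‖ < 1) (A s : ℤ) :
    HasSum (fun i : ℤ => q ^ (i * (i + s)) * qFactInv q (A - i) * qFactInv q i * qFactInv q (i + s))
      (qFactInv q A * qFactInv q (A + s)) := by
  rcases lt_or_ge A 0 with hA | hA
  · rw [qFactInv_of_neg hA, zero_mul]
    refine hasSum_zero.of_eq (fun i => ?_) rfl
    by_cases hi : i < 0
    · rw [qFactInv_of_neg hi]; ring
    · rw [qFactInv_of_neg (n := A - i) (by omega)]; ring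
  · lift A to ℕ using hA
    refine ((hasSum_qBinom_mul_qFactInv h0 hq A s).mul_left (qFactInv q A)).of_eq (fun i => ?_) rfl
    have : qPoch q q (A : ℤ).toNat * qFactInv q A = 1 := by
      rw [Int.toNat_natCast, qFactInv_natCast, mul_inv_cancel₀ (qPoch_self_ne_zero hq A)]
    rw [qBinom_eq]
    linear_combination (-(q ^ (i * (i + s)) * qFactInv q (A - i) * qFactInv q i
      * qFactInv q (i + s))) * this

/-- Bailey's lemma in the form needed here: the sum over `k` reproduces the same kernel. -/
theorem hasSum_bailey {q : ℂ} (h0 : q ≠ 0) (hq : ‖q‖ < 1) (M r Δ : ℤ) :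
    HasSum (fun k : ℤ => q ^ (k * k + Δ * k) * qFactInv q (M - k)
        * (qFactInv q (k - r) * qFactInv q (k + Δ + r)))
      (q ^ (r * r + Δ * r) * (qFactInv q (M - r) * qFactInv q (M + Δ + r))) := by
  have h := ((Equiv.addRight (-r)).hasSum_iff.mpr
    (hasSum_qFactInv_vandermonde h0 hq (M - r) (2 * r + Δ))).mul_left (q ^ (r * r + Δ * r))
  refine h.of_eq (fun k => ?_) (by rw [show M - r + (2 * r + Δ) = M + Δ + r by ring])
  simp only [Function.comp_apply, Equiv.coe_addRight]
  rw [show M - r - (k + -r) = M - k by ring, show k + -r + (2 * r + Δ) = k + Δ + r by ring,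
    show k * k + Δ * k = (r * r + Δ * r) + (k + -r) * (k + Δ + r) by ring, zpow_add₀ h0,
    ← sub_eq_add_neg]
  ring

theorem hasSum_bailey_limit {q : ℂ} (h0 : q ≠ 0) (hq : ‖q‖ < 1) (r Δ : ℤ) :
    HasSum (fun M : ℤ => q ^ (M * M + Δ * M) * (qFactInv q (M - r) * qFactInv q (M + Δ + r)))
      (q ^ (r * r + Δ * r) * (qPochInf q q)⁻¹) := by
  have h := ((Equiv.addRight (-r)).hasSum_iff.mpr
    (hasSum_durfee h0 hq (2 * r + Δ))).mul_left (q ^ (r * r + Δ * r))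
  refine h.of_eq (fun k => ?_) rfl
  simp only [Function.comp_apply, Equiv.coe_addRight]
  rw [show k + -r + (2 * r + Δ) = k + Δ + r by ring,
    show k * k + Δ * k = (r * r + Δ * r) + (k + -r) * (k + Δ + r) by ring, zpow_add₀ h0,
    ← sub_eq_add_neg]
  ring

theorem norm_mul_three_le {C : ℝ} {x y z : ℂ} (hx : ‖x‖ ≤ C) (hy : ‖y‖ ≤ C)
    (hz : ‖z‖ ≤ C) : ‖x * (y * z)‖ ≤ C ^ 3 := by
  have hC := (norm_nonneg x).trans hx
  rw [norm_mul, norm_mul, pow_succ', pow_two]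
  gcongr

theorem summable_pow_mul_pow {ρ : ℝ} (h0 : 0 ≤ ρ) (h1 : ρ < 1) :
    Summable fun p : ℕ × ℕ => ρ ^ (p.1 + p.2) := by
  have h := summable_geometric_of_lt_one h0 h1
  refine (h.mul_of_nonneg h (fun _ => pow_nonneg h0 _) fun _ => pow_nonneg h0 _).congr fun p => ?_
  rw [pow_add]

theorem norm_pow_le_pow {q : ℂ} (hq : ‖q‖ < 1) {m n : ℕ} (h : m ≤ n) : ‖q ^ n‖ ≤ ‖q‖ ^ m := by
  rw [norm_pow]
  exact pow_le_pow_of_le_one (norm_nonneg q) hq.le h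

/-- Two applications of Bailey's lemma, in the variables `M = m + k` and `k`. The condition on `r`
ensures that the terms with `k < 0`, which Bailey's lemma includes, are zero. -/
theorem hasSum_double_bailey {q : ℂ} (h0 : q ≠ 0) (hq : ‖q‖ < 1) (Δ : ℕ) {r : ℤ}
    (hr : 0 ≤ r ∨ r ≤ -Δ) :
    HasSum (fun p : ℕ × ℕ => q ^ ((p.1 + p.2) ^ 2 + p.2 ^ 2 + Δ * (p.1 + 2 * p.2))
        * (qFactInv q p.1 * (qFactInv q (p.2 - r) * qFactInv q (p.2 + Δ + r))))
      (q ^ (2 * (r * r + Δ * r)) * (qPochInf q q)⁻¹) := by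
  obtain ⟨C, hC1, hC⟩ := exists_norm_qFactInv_le hq
  set T : ℤ × ℤ → ℂ := fun x => q ^ (x.1 * x.1 + Δ * x.1) * (q ^ (x.2 * x.2 + Δ * x.2)
    * qFactInv q (x.1 - x.2) * (qFactInv q (x.2 - r) * qFactInv q (x.2 + Δ + r))) with hT
  set φ : ℕ × ℕ → ℤ × ℤ := fun p => (p.1 + p.2, p.2) with hφ
  have hinj : Function.Injective φ := by
    rintro ⟨m, k⟩ ⟨m', k'⟩ h
    simp only [hφ, Prod.mk.injEq] at h ⊢
    omega
  have hout : ∀ x ∉ Set.range φ, T x = 0 := by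
    rintro ⟨M, k⟩ hx
    simp only [hT]
    by_cases hk : k < 0
    · rcases hr with hr | hr
      · rw [qFactInv_of_neg (n := k - r) (by omega)]; ring
      · rw [qFactInv_of_neg (n := k + Δ + r) (by omega)]; ring
    · rw [qFactInv_of_neg (n := M - k)]
      · ring
      · by_contra hMk
        refine hx ⟨((M - k).toNat, k.toNat), ?_⟩
        simp only [hφ, Prod.mk.injEq]
        omega
  have hcomp : ∀ p : ℕ × ℕ, q ^ ((p.1 + p.2) ^ 2 + p.2 ^ 2 + Δ * (p.1 + 2 * p.2))
        * (qFactInv q p.1 * (qFactInv q (p.2 - r) * qFactInv q (p.2 + Δ + r))) = T (φ p) := by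
    rintro ⟨m, k⟩
    simp only [hT, hφ]
    rw [add_sub_cancel_right, ← zpow_natCast,
      show ((((m + k) ^ 2 + k ^ 2 + Δ * (m + 2 * k) : ℕ)) : ℤ)
        = ((m : ℤ) + k) * (m + k) + Δ * (m + k) + ((k : ℤ) * k + Δ * k) by push_cast; ring,
      zpow_add₀ h0]
    ring
  have hs : Summable T := by
    rw [← hinj.summable_iff hout]
    refine Summable.of_norm_bounded ((summable_pow_mul_pow (norm_nonneg q) hq).mul_right (C ^ 3))
      fun p => ?_
    rw [Function.comp_apply, ← hcomp, norm_mul]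
    gcongr
    · refine norm_pow_le_pow hq ((Nat.le_self_pow two_ne_zero _).trans ?_)
      rw [add_assoc]
      exact Nat.le_add_right _ _
    · exact norm_mul_three_le (hC _) (hC _) (hC _)
  have hrows := HasSum.of_rows hs (fun M => (hasSum_bailey h0 hq M r Δ).mul_left (q ^ (M * M + Δ * M)))
    (((hasSum_bailey_limit h0 hq r Δ).mul_left (q ^ (r * r + Δ * r))).of_eq
      (fun M => by ring) rfl)
  refine ((hinj.hasSum_iff hout).mpr hrows).of_eq hcomp ?_
  rw [two_mul, zpow_add₀ h0, mul_assoc]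

theorem two_mul_choose_two (n : ℕ) : (2 * (n + 1).choose 2 : ℤ) = n * (n + 1) := by
  induction n with
  | zero => simp
  | succ n ih =>
    rw [Nat.choose_succ_succ' (n + 1) 1, Nat.choose_one_right]
    push_cast
    linarith

theorem hasSum_of_even_odd {f : ℕ × ℕ → ℂ} {a b : ℂ}
    (he : HasSum (fun p : ℕ × ℕ => f (p.1, 2 * p.2)) a)
    (ho : HasSum (fun p : ℕ × ℕ => f (p.1, 2 * p.2 + 1)) b) : HasSum f (a + b) := by
  have i1 : Function.Injective fun p : ℕ × ℕ => (p.1, 2 * p.2) := by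
    rintro ⟨m, k⟩ ⟨m', k'⟩ h
    simp only [Prod.mk.injEq] at h ⊢
    omega
  have i2 : Function.Injective fun p : ℕ × ℕ => (p.1, 2 * p.2 + 1) := by
    rintro ⟨m, k⟩ ⟨m', k'⟩ h
    simp only [Prod.mk.injEq] at h ⊢
    omega
  refine HasSum.add_isCompl (s := Set.range fun p : ℕ × ℕ => (p.1, 2 * p.2))
    (t := Set.range fun p : ℕ × ℕ => (p.1, 2 * p.2 + 1)) ⟨?_, ?_⟩
    (i1.hasSum_range_iff.mpr he) (i2.hasSum_range_iff.mpr ho)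
  · rw [Set.disjoint_left]
    rintro ⟨m, k⟩ ⟨⟨m', k'⟩, h⟩ ⟨⟨m'', k''⟩, h'⟩
    simp only [Prod.mk.injEq] at h h'
    omega
  · rw [codisjoint_iff_le_sup]
    rintro ⟨m, k⟩ -
    rcases Nat.even_or_odd' k with ⟨c, rfl | rfl⟩
    · exact Or.inl ⟨(m, c), rfl⟩
    · exact Or.inr ⟨(m, c), rfl⟩

/-- The analogue of `hasSum_double_bailey` for triangular exponents. The terms with `k` even
and those with `k` odd are not summable in closed form, but they combine to a single kernel by
`q^M + q^r (1 - q^(M-r)) = q^r`. -/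
theorem hasSum_triangular_bailey {q : ℂ} (h0 : q ≠ 0) (hq : ‖q‖ < 1) (r : ℤ) :
    HasSum (fun p : ℕ × ℕ => q ^ ((p.1 + 1).choose 2 + (p.1 + p.2 + 1).choose 2)
        * (qFactInv q p.1 * (qFactInv q ((p.2 / 2 : ℕ) - r)
          * qFactInv q ((p.2 : ℤ) - ((p.2 / 2 : ℕ) - r)))))
      (q ^ (2 * (r * r) + r) * (qPochInf q q)⁻¹) := by
  obtain ⟨C, hC1, hC⟩ := exists_norm_qFactInv_le hq
  set h : ℕ × ℕ → ℂ := fun p => q ^ ((p.1 + 1).choose 2 + (p.1 + p.2 + 1).choose 2)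
        * (qFactInv q p.1 * (qFactInv q ((p.2 / 2 : ℕ) - r)
          * qFactInv q ((p.2 : ℤ) - ((p.2 / 2 : ℕ) - r)))) with hh
  have hsum : Summable h := by
    refine Summable.of_norm_bounded ((summable_pow_mul_pow (norm_nonneg q) hq).mul_right (C ^ 3))
      fun p => ?_
    simp only [hh]
    rw [norm_mul]
    gcongr
    · refine norm_pow_le_pow hq ?_
      have e1 := two_mul_choose_two p.1
      have e2 := two_mul_choose_two (p.1 + p.2)
      have e3 : ((p.1 : ℤ) + p.2) * 2 ≤ p.1 * (p.1 + 1) + (p.1 + p.2) * (p.1 + p.2 + 1) := by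
        have a1 : (p.1 : ℤ) + p.2 ≤ (p.1 + p.2) * (p.1 + p.2) := by
          exact_mod_cast Nat.le_mul_self (p.1 + p.2)
        nlinarith [Int.natCast_nonneg p.1, Int.natCast_nonneg p.2]
      zify
      push_cast at e2
      linarith
    · exact norm_mul_three_le (hC _) (hC _) (hC _)
  set T₀ : ℤ × ℤ → ℂ := fun x => q ^ (x.1 * x.1 + x.1) * (q ^ (x.2 * x.2 + 0 * x.2)
    * qFactInv q (x.1 - x.2) * (qFactInv q (x.2 - r) * qFactInv q (x.2 + 0 + r))) with hT₀
  set T₁ : ℤ × ℤ → ℂ := fun x => q ^ (x.1 * x.1) * (q ^ (x.2 * x.2 + 1 * x.2)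
    * qFactInv q (x.1 - 1 - x.2) * (qFactInv q (x.2 - r) * qFactInv q (x.2 + 1 + r))) with hT₁
  set φ₀ : ℕ × ℕ → ℤ × ℤ := fun p => (p.1 + p.2, p.2) with hφ₀
  set φ₁ : ℕ × ℕ → ℤ × ℤ := fun p => (p.1 + p.2 + 1, p.2) with hφ₁
  have hinj₀ : Function.Injective φ₀ := by
    rintro ⟨m, k⟩ ⟨m', k'⟩ h
    simp only [hφ₀, Prod.mk.injEq] at h ⊢
    omega
  have hinj₁ : Function.Injective φ₁ := by
    rintro ⟨m, k⟩ ⟨m', k'⟩ h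
    simp only [hφ₁, Prod.mk.injEq] at h ⊢
    omega
  have hout₀ : ∀ x ∉ Set.range φ₀, T₀ x = 0 := by
    rintro ⟨M, k⟩ hx
    simp only [hT₀]
    by_cases hk : k < 0
    · rcases le_total 0 r with hr | hr
      · rw [qFactInv_of_neg (n := k - r) (by omega)]; ring
      · rw [qFactInv_of_neg (n := k + 0 + r) (by omega)]; ring
    · rw [qFactInv_of_neg (n := M - k)]
      · ring
      · by_contra hMk
        refine hx ⟨((M - k).toNat, k.toNat), ?_⟩
        simp only [hφ₀, Prod.mk.injEq]
        omega
  have hout₁ : ∀ x ∉ Set.range φ₁, T₁ x = 0 := by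
    rintro ⟨M, k⟩ hx
    simp only [hT₁]
    by_cases hk : k < 0
    · rcases le_or_gt 0 r with hr | hr
      · rw [qFactInv_of_neg (n := k - r) (by omega)]; ring
      · rw [qFactInv_of_neg (n := k + 1 + r) (by omega)]; ring
    · rw [qFactInv_of_neg (n := M - 1 - k)]
      · ring
      · by_contra hMk
        refine hx ⟨((M - 1 - k).toNat, k.toNat), ?_⟩
        simp only [hφ₁, Prod.mk.injEq]
        omega
  have hcomp₀ : ∀ p : ℕ × ℕ, h (p.1, 2 * p.2) = T₀ (φ₀ p) := by
    rintro ⟨m, k⟩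
    simp only [hh, hT₀, hφ₀]
    have e1 := two_mul_choose_two m
    have e2 := two_mul_choose_two (m + 2 * k)
    push_cast at e2
    rw [← zpow_natCast, show (((m + 1).choose 2 + (m + 2 * k + 1).choose 2 : ℕ) : ℤ)
        = ((m : ℤ) + k) * (m + k) + (m + k) + ((k : ℤ) * k + 0 * k) by
          push_cast; linarith, zpow_add₀ h0, add_sub_cancel_right,
      show 2 * k / 2 = k by omega, show ((2 * k : ℕ) : ℤ) - (k - r) = k + 0 + r by push_cast; ring]
    ring
  have hcomp₁ : ∀ p : ℕ × ℕ, h (p.1, 2 * p.2 + 1) = T₁ (φ₁ p) := by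
    rintro ⟨m, k⟩
    simp only [hh, hT₁, hφ₁]
    have e1 := two_mul_choose_two m
    have e2 := two_mul_choose_two (m + (2 * k + 1))
    push_cast at e2
    rw [← zpow_natCast, show (((m + 1).choose 2 + (m + (2 * k + 1) + 1).choose 2 : ℕ) : ℤ)
        = ((m : ℤ) + k + 1) * (m + k + 1) + ((k : ℤ) * k + 1 * k) by
          push_cast; linarith, zpow_add₀ h0,
      show (2 * k + 1) / 2 = k by omega,
      show ((2 * k + 1 : ℕ) : ℤ) - (k - r) = k + 1 + r by push_cast; ring,
      show (m : ℤ) + k + 1 - 1 - k = m by ring]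
    ring
  have hs₀ : Summable T₀ := by
    rw [← hinj₀.summable_iff hout₀]
    refine (hsum.comp_injective (i := fun p : ℕ × ℕ => (p.1, 2 * p.2)) ?_).congr hcomp₀
    rintro ⟨m, k⟩ ⟨m', k'⟩ h
    simp only [Prod.mk.injEq] at h ⊢
    omega
  have hs₁ : Summable T₁ := by
    rw [← hinj₁.summable_iff hout₁]
    refine (hsum.comp_injective (i := fun p : ℕ × ℕ => (p.1, 2 * p.2 + 1)) ?_).congr hcomp₁
    rintro ⟨m, k⟩ ⟨m', k'⟩ h
    simp only [Prod.mk.injEq] at h ⊢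
    omega
  have hrows := HasSum.of_rows (hs₀.add hs₁)
    (fun M => ((hasSum_bailey h0 hq M r 0).mul_left (q ^ (M * M + M))).add
      ((hasSum_bailey h0 hq (M - 1) r 1).mul_left (q ^ (M * M))))
    (((hasSum_bailey_limit h0 hq r 0).mul_left (q ^ (r * r + r))).of_eq (fun M => by
      have e1 := qFactInv_sub_one hq (M - r)
      rw [show M - 1 - r = M - r - 1 by ring, e1, show M - 1 + 1 + r = M + r by ring, add_zero,
        zero_mul, zero_mul, add_zero, add_zero, zpow_add₀ h0 (M * M) M, one_mul,
        zpow_add₀ h0 (r * r) r]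
      have e2 : q ^ M = q ^ r * q ^ (M - r) := by rw [← zpow_add₀ h0]; congr 1; ring
      rw [e2]
      ring) rfl)
  have htot := hs₀.hasSum.add hs₁.hasSum
  have hval := hrows.unique htot
  have hfin := hasSum_of_even_odd
    (((hinj₀.hasSum_iff hout₀).mpr hs₀.hasSum).of_eq hcomp₀ rfl)
    (((hinj₁.hasSum_iff hout₁).mpr hs₁.hasSum).of_eq hcomp₁ rfl)
  refine hfin.of_eq (fun _ => rfl) ?_
  rw [← hval, ← mul_assoc (q ^ (r * r + r)), ← zpow_add₀ h0]
  congr 2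
  ring

/-! ### Interchange of summation and the theta series -/

theorem exists_norm_innerSummand_le {q : ℂ} (hq : ‖q‖ < 1) (ε r : ℕ) :
    ∃ C : ℝ, 0 ≤ C ∧ ∀ Δ K n, ‖innerSummand q ε r Δ K n‖ ≤ ‖q‖ ^ (∑ i, n i) * C := by
  obtain ⟨D, hD1, hD⟩ := exists_norm_qBinom_le hq
  obtain ⟨D', hD1', hD'⟩ := exists_norm_qBinom_le (q := q ^ 2) (by
    rw [norm_pow]; exact pow_lt_one₀ (norm_nonneg q) hq two_ne_zero)
  refine ⟨D' * D ^ r, by positivity, fun Δ K n => ?_⟩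
  rw [innerSummand, norm_mul, norm_mul, norm_prod, mul_assoc]
  gcongr
  · refine norm_pow_le_pow hq ?_
    rw [sum_Icc_one_succ, tailSum_one]
    have := Nat.le_self_pow two_ne_zero (∑ i, n i)
    omega
  · exact hD' _ _
  · refine (prod_le_prod (fun _ _ => norm_nonneg _) fun j _ => hD _ _).trans ?_
    simp

/-- Interchange of summation: if for each `p` the sums of `f` over `n` and of `h` over `j` agree,
then `f` is summed by summing `h` over `p` first. -/
theorem HasSum.interchange {α β γ : Type*} {f : α × β → ℂ} {h : α × γ → ℂ} {Φ : α → ℂ} {θ : γ → ℂ}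
    {S : ℂ} (hf : Summable f) (hh : Summable h) (hfΦ : ∀ p, HasSum (fun n => f (p, n)) (Φ p))
    (hhΦ : ∀ p, HasSum (fun j => h (p, j)) (Φ p)) (hθ : ∀ j, HasSum (fun p => h (p, j)) (θ j))
    (hS : HasSum θ S) : HasSum f S :=
  HasSum.of_rows hf hfΦ ((HasSum.of_cols hh hθ hS).prod_fiberwise hhΦ)

theorem summable_of_norm_le_pow {q : ℂ} (hq : ‖q‖ < 1) {s : ℕ} {f : (ℕ × ℕ) × (Fin s → ℕ) → ℂ}
    (C : ℝ) (hf : ∀ p n, ‖f (p, n)‖ ≤ ‖q‖ ^ (p.1 + p.2) * ‖q‖ ^ (∑ i, n i) * C) : Summable f :=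
  Summable.of_norm_bounded (((summable_pow_mul_pow (norm_nonneg q) hq).mul_of_nonneg
    (summable_pow_sum (norm_nonneg q) hq s) (fun _ => by positivity)
      fun _ => by positivity).mul_right C) fun x => hf x.1 x.2

theorem summable_of_norm_le_zpow_abs {q : ℂ} (h0 : q ≠ 0) (hq : ‖q‖ < 1) {f : (ℕ × ℕ) × ℤ → ℂ}
    (C : ℝ) (hf : ∀ p j, ‖f (p, j)‖ ≤ ‖q‖ ^ (p.1 + p.2) * ‖q‖ ^ |j| * C) : Summable f :=
  Summable.of_norm_bounded (((summable_pow_mul_pow (norm_nonneg q) hq).mul_of_nonneg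
    (summable_zpow_abs (norm_pos_iff.mpr h0) hq) (fun _ => by positivity)
      fun _ => by positivity).mul_right C) fun x => hf x.1 x.2

/-- The inner multisum, for each upper parameter `2k + Δ`, as an alternating sum. -/
theorem exists_hasSum_innerSummand {q : ℂ} (h0 : q ≠ 0) (hq : ‖q‖ < 1) {ε : ℕ} (hε : ε ≤ 1)
    {r Δ : ℕ} (hΔ : Δ ≤ r + 1) (k : ℕ) :
    ∃ S, HasSum (innerSummand q ε r Δ k) S ∧
      HasSum (fun j : ℤ => (-1) ^ j * q ^ (((r : ℤ) + 2) * (j * j) + ε * Δ * j)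
        * qBinom q (2 * k + Δ) (k - (r + 2) * j)) S := by
  obtain ⟨S, h1, h2⟩ := exists_hasSum_burgeSummand_limit h0 hq hε r hΔ k
  exact ⟨S, h1.of_eq (fun n => innerSummand_eq_burgeSummand q ε hΔ k n) rfl, h2⟩

theorem abs_le_theta_exponent {v ε Δ : ℕ} (hε : ε ≤ 1) (hΔ : Δ < v) (j : ℤ) :
    |j| ≤ (v : ℤ) * (j * j) + ε * Δ * j := by
  have h1 : (ε * Δ : ℤ) ≤ v - 1 := by
    have : ε * Δ ≤ 1 * Δ := Nat.mul_le_mul_right _ hε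
    zify at this hΔ
    linarith
  have h2 : (0 : ℤ) ≤ ε * Δ := by positivity
  have hv : (1 : ℤ) ≤ v := by omega
  have h3 : |j| * |j| = j * j := abs_mul_abs_self j
  have h4 : |j| ≤ |j| * |j| := by
    rcases (abs_nonneg j).eq_or_lt with h | h
    · rw [← h]; simp
    · nlinarith
  have h5 : -((v - 1) * |j|) ≤ (ε * Δ : ℤ) * j := by
    have a1 : -((ε * Δ : ℤ) * |j|) ≤ (ε * Δ : ℤ) * j := by nlinarith [neg_abs_le j]
    nlinarith [abs_nonneg j]
  nlinarith

/-- The triple product with modulus `2v(2v + 1)`, divided by `(q; q)_∞`. -/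
theorem hasSum_theta {q : ℂ} (h0 : q ≠ 0) (hq : ‖q‖ < 1) {v γ α β : ℕ} (hα : 0 < α)
    (hαγ : α + γ = v * (2 * v + 1)) (hβ : β = v * (2 * v + 1) + γ) :
    HasSum (fun j : ℤ => (-1) ^ j * q ^ ((v : ℤ) * (2 * v + 1) * (j * j) + γ * j)
        * (qPochInf q q)⁻¹)
      (qPochInf (q ^ (2 * v * (2 * v + 1))) (q ^ (2 * v * (2 * v + 1)))
        * qPochInf (q ^ α) (q ^ (2 * v * (2 * v + 1)))
        * qPochInf (q ^ β) (q ^ (2 * v * (2 * v + 1))) / qPochInf q q) := by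
  have h := (hasSum_triple_product h0 hq hα (show 0 < β by omega)).mul_right (qPochInf q q)⁻¹
  rw [show α + β = 2 * v * (2 * v + 1) by rw [hβ, mul_assoc, ← hαγ]; ring, ← div_eq_mul_inv] at h
  refine h.of_eq (fun j => ?_) rfl
  congr 3
  have h2 : j * (j - 1) / 2 * 2 = j * (j - 1) :=
    Int.ediv_mul_cancel (Int.even_mul_pred_self j).two_dvd
  have h3 : (α : ℤ) = v * (2 * v + 1) - γ := by zify at hαγ; linarith
  have h4 : (β : ℤ) = v * (2 * v + 1) + γ := by rw [hβ]; push_cast; ring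
  rw [h3, h4]
  linear_combination (-(v : ℤ) * (2 * v + 1)) * h2

/-- The multisum with quadratic exponents in `m` and `k`. -/
theorem hasSum_quadratic_multisum {q : ℂ} (h0 : q ≠ 0) (hq : ‖q‖ < 1) {ε : ℕ} (hε : ε ≤ 1)
    {r Δ : ℕ} (hΔ : Δ ≤ r + 1) {S : ℂ}
    (hS : HasSum (fun j : ℤ => (-1) ^ j * q ^ (((r + 2 : ℕ) : ℤ) * (2 * (r + 2 : ℕ) + 1) * (j * j)
      + (Δ * (2 * (r + 2) + ε) : ℕ) * j) * (qPochInf q q)⁻¹) S) :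
    HasSum (fun x : ℕ × ℕ × (Fin (r + 1) → ℕ) =>
      q ^ ((x.1 + x.2.1) ^ 2 + x.2.1 ^ 2 + Δ * (x.1 + 2 * x.2.1))
        * (1 / (qPoch q q x.1 * qPoch q q (2 * x.2.1 + Δ)))
        * innerSummand q ε r Δ x.2.1 x.2.2) S := by
  obtain ⟨C, hC1, hC⟩ := exists_norm_qFactInv_le hq
  obtain ⟨D, hD0, hD⟩ := exists_norm_innerSummand_le hq ε r
  choose Φ hΦ1 hΦ2 using exists_hasSum_innerSummand h0 hq hε hΔ
  set c : ℕ × ℕ → ℂ := fun p => q ^ ((p.1 + p.2) ^ 2 + p.2 ^ 2 + Δ * (p.1 + 2 * p.2))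
        * (1 / (qPoch q q p.1 * qPoch q q (2 * p.2 + Δ))) with hc
  have hexp : ∀ p : ℕ × ℕ, p.1 + p.2 ≤ (p.1 + p.2) ^ 2 + p.2 ^ 2 + Δ * (p.1 + 2 * p.2) :=
    fun p => (Nat.le_self_pow two_ne_zero _).trans (by rw [add_assoc]; exact Nat.le_add_right _ _)
  have hcle : ∀ p, ‖c p‖ ≤ ‖q‖ ^ (p.1 + p.2) * (C * C) := by
    intro p
    simp only [hc]
    rw [one_div, mul_inv, ← qFactInv_natCast, ← qFactInv_natCast, norm_mul, norm_mul]
    gcongr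
    exacts [norm_pow_le_pow hq (hexp p), hC _, hC _]
  have hker : ∀ (p : ℕ × ℕ) (j : ℤ), c p * ((-1) ^ j * q ^ (((r : ℤ) + 2) * (j * j) + ε * Δ * j)
        * qBinom q (2 * p.2 + Δ) (p.2 - (r + 2) * j))
      = (-1) ^ j * q ^ (((r : ℤ) + 2) * (j * j) + ε * Δ * j)
        * (q ^ ((p.1 + p.2) ^ 2 + p.2 ^ 2 + Δ * (p.1 + 2 * p.2)) * (qFactInv q p.1
          * (qFactInv q (p.2 - (r + 2) * j) * qFactInv q (p.2 + Δ + (r + 2) * j)))) := by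
    intro p j
    simp only [hc]
    rw [one_div, mul_inv, ← qFactInv_natCast, qBinom_eq,
      show (2 * (p.2 : ℤ) + Δ).toNat = 2 * p.2 + Δ by omega,
      show 2 * (p.2 : ℤ) + Δ - (p.2 - (r + 2) * j) = p.2 + Δ + (r + 2) * j by ring]
    have := inv_mul_cancel₀ (qPoch_self_ne_zero hq (2 * p.2 + Δ))
    linear_combination ((-1) ^ j * q ^ (((r : ℤ) + 2) * (j * j) + ε * Δ * j)
        * (q ^ ((p.1 + p.2) ^ 2 + p.2 ^ 2 + Δ * (p.1 + 2 * p.2)) * (qFactInv q p.1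
          * (qFactInv q (p.2 - (r + 2) * j) * qFactInv q (p.2 + Δ + (r + 2) * j))))) * this
  have hmain : HasSum (fun x : (ℕ × ℕ) × (Fin (r + 1) → ℕ) =>
      c x.1 * innerSummand q ε r Δ x.1.2 x.2) S := by
    refine HasSum.interchange (h := fun x : (ℕ × ℕ) × ℤ => c x.1 * ((-1) ^ x.2
        * q ^ (((r : ℤ) + 2) * (x.2 * x.2) + ε * Δ * x.2)
        * qBinom q (2 * x.1.2 + Δ) (x.1.2 - (r + 2) * x.2)))
      (summable_of_norm_le_pow hq (C * C * D) fun p n => ?_)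
      (summable_of_norm_le_zpow_abs h0 hq (C ^ 3) fun p j => ?_)
      (fun p => (hΦ1 p.2).mul_left (c p)) (fun p => (hΦ2 p.2).mul_left (c p)) (fun j => ?_) hS
    · rw [norm_mul]
      refine (mul_le_mul (hcle p) (hD _ _ _) (norm_nonneg _) (by positivity)).trans (le_of_eq ?_)
      ring
    · simp only
      rw [hker, norm_mul, norm_mul, norm_mul]
      have e1 := norm_zpow_le h0 hq (abs_le_theta_exponent (v := r + 2) hε
        (by omega : Δ < r + 2) j)
      push_cast at e1
      calc _ ≤ 1 * ‖q‖ ^ |j| * (‖q‖ ^ (p.1 + p.2) * C ^ 3) := by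
            gcongr
            · simp
            · exact norm_pow_le_pow hq (hexp p)
            · exact norm_mul_three_le (hC _) (hC _) (hC _)
        _ = _ := by ring
    · have hr : 0 ≤ ((r : ℤ) + 2) * j ∨ ((r : ℤ) + 2) * j ≤ -Δ := by
        rcases le_or_gt 0 j with h | h
        · left; positivity
        · right; nlinarith
      refine ((hasSum_double_bailey h0 hq Δ hr).mul_left
        ((-1) ^ j * q ^ (((r : ℤ) + 2) * (j * j) + ε * Δ * j))).of_eq (fun p => hker p j) ?_
      have : q ^ (((r + 2 : ℕ) : ℤ) * (2 * (r + 2 : ℕ) + 1) * (j * j)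
            + (Δ * (2 * (r + 2) + ε) : ℕ) * j)
          = q ^ (((r : ℤ) + 2) * (j * j) + ε * Δ * j)
            * q ^ (2 * (((r : ℤ) + 2) * j * (((r : ℤ) + 2) * j) + Δ * (((r : ℤ) + 2) * j))) := by
        rw [← zpow_add₀ h0]; congr 1; push_cast; ring
      rw [this]
      ring
  exact ((Equiv.prodAssoc ℕ ℕ (Fin (r + 1) → ℕ)).symm.hasSum_iff.mpr hmain)

/-- The multisum with triangular exponents in `m` and `k`. -/
theorem hasSum_triangular_multisum {q : ℂ} (h0 : q ≠ 0) (hq : ‖q‖ < 1) {r : ℕ} {S : ℂ}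
    (hS : HasSum (fun j : ℤ => (-1) ^ j * q ^ (((r + 2 : ℕ) : ℤ) * (2 * (r + 2 : ℕ) + 1) * (j * j)
      + (r + 2 : ℕ) * j) * (qPochInf q q)⁻¹) S) :
    HasSum (fun x : ℕ × ℕ × (Fin (r + 1) → ℕ) =>
      q ^ ((x.1 + 1).choose 2 + (x.1 + x.2.1 + 1).choose 2)
        * (1 / (qPoch q q x.1 * qPoch q q x.2.1))
        * innerSummand q 0 r (x.2.1 % 2) (x.2.1 / 2 : ℕ) x.2.2) S := by
  obtain ⟨C, hC1, hC⟩ := exists_norm_qFactInv_le hq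
  obtain ⟨D, hD0, hD⟩ := exists_norm_innerSummand_le hq 0 r
  choose Φ hΦ1 hΦ2 using fun k : ℕ => exists_hasSum_innerSummand h0 hq (zero_le_one)
    (show k % 2 ≤ r + 1 by omega) (k / 2)
  set c : ℕ × ℕ → ℂ := fun p => q ^ ((p.1 + 1).choose 2 + (p.1 + p.2 + 1).choose 2)
        * (1 / (qPoch q q p.1 * qPoch q q p.2)) with hc
  have hexp : ∀ p : ℕ × ℕ, p.1 + p.2 ≤ (p.1 + 1).choose 2 + (p.1 + p.2 + 1).choose 2 := by
    intro p
    refine le_trans ?_ (Nat.le_add_left _ _)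
    rw [Nat.choose_succ_succ' _ 1, Nat.choose_one_right]
    exact Nat.le_add_right _ _
  have hcle : ∀ p, ‖c p‖ ≤ ‖q‖ ^ (p.1 + p.2) * (C * C) := by
    intro p
    simp only [hc]
    rw [one_div, mul_inv, ← qFactInv_natCast, ← qFactInv_natCast, norm_mul, norm_mul]
    gcongr
    exacts [norm_pow_le_pow hq (hexp p), hC _, hC _]
  have hker : ∀ (p : ℕ × ℕ) (j : ℤ), c p * ((-1) ^ j
        * q ^ (((r : ℤ) + 2) * (j * j) + (0 : ℕ) * (p.2 % 2 : ℕ) * j)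
        * qBinom q (2 * (p.2 / 2 : ℕ) + (p.2 % 2 : ℕ)) ((p.2 / 2 : ℕ) - (r + 2) * j))
      = (-1) ^ j * q ^ (((r : ℤ) + 2) * (j * j))
        * (q ^ ((p.1 + 1).choose 2 + (p.1 + p.2 + 1).choose 2) * (qFactInv q p.1
          * (qFactInv q ((p.2 / 2 : ℕ) - (r + 2) * j)
            * qFactInv q ((p.2 : ℤ) - ((p.2 / 2 : ℕ) - (r + 2) * j))))) := by
    intro p j
    simp only [hc]
    rw [one_div, mul_inv, ← qFactInv_natCast, qBinom_eq,
      show 2 * ((p.2 / 2 : ℕ) : ℤ) + (p.2 % 2 : ℕ) = p.2 by omega, Int.toNat_natCast,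
      Nat.cast_zero, zero_mul, zero_mul, add_zero]
    have := inv_mul_cancel₀ (qPoch_self_ne_zero hq p.2)
    linear_combination ((-1) ^ j * q ^ (((r : ℤ) + 2) * (j * j))
        * (q ^ ((p.1 + 1).choose 2 + (p.1 + p.2 + 1).choose 2) * (qFactInv q p.1
          * (qFactInv q ((p.2 / 2 : ℕ) - (r + 2) * j)
            * qFactInv q ((p.2 : ℤ) - ((p.2 / 2 : ℕ) - (r + 2) * j)))))) * this
  have hmain : HasSum (fun x : (ℕ × ℕ) × (Fin (r + 1) → ℕ) =>
      c x.1 * innerSummand q 0 r (x.1.2 % 2) (x.1.2 / 2 : ℕ) x.2) S := by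
    refine HasSum.interchange (h := fun x : (ℕ × ℕ) × ℤ => c x.1 * ((-1) ^ x.2
        * q ^ (((r : ℤ) + 2) * (x.2 * x.2) + (0 : ℕ) * (x.1.2 % 2 : ℕ) * x.2)
        * qBinom q (2 * (x.1.2 / 2 : ℕ) + (x.1.2 % 2 : ℕ)) ((x.1.2 / 2 : ℕ) - (r + 2) * x.2)))
      (summable_of_norm_le_pow hq (C * C * D) fun p n => ?_)
      (summable_of_norm_le_zpow_abs h0 hq (C ^ 3) fun p j => ?_)
      (fun p => (hΦ1 p.2).mul_left (c p)) (fun p => (hΦ2 p.2).mul_left (c p)) (fun j => ?_) hS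
    · rw [norm_mul]
      refine (mul_le_mul (hcle p) (hD _ _ _) (norm_nonneg _) (by positivity)).trans (le_of_eq ?_)
      ring
    · simp only
      rw [hker, norm_mul, norm_mul, norm_mul]
      have e1 := norm_zpow_le h0 hq (abs_le_theta_exponent (v := r + 2) zero_le_one
        (by omega : 0 < r + 2) j)
      push_cast at e1
      rw [zero_mul, add_zero] at e1
      calc _ ≤ 1 * ‖q‖ ^ |j| * (‖q‖ ^ (p.1 + p.2) * C ^ 3) := by
            gcongr
            · simp
            · exact norm_pow_le_pow hq (hexp p)
            · exact norm_mul_three_le (hC _) (hC _) (hC _)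
        _ = _ := by ring
    · refine ((hasSum_triangular_bailey h0 hq (((r : ℤ) + 2) * j)).mul_left
        ((-1) ^ j * q ^ (((r : ℤ) + 2) * (j * j)))).of_eq (fun p => hker p j) ?_
      have : q ^ (((r + 2 : ℕ) : ℤ) * (2 * (r + 2 : ℕ) + 1) * (j * j) + (r + 2 : ℕ) * j)
          = q ^ (((r : ℤ) + 2) * (j * j))
            * q ^ (2 * (((r : ℤ) + 2) * j * (((r : ℤ) + 2) * j)) + ((r : ℤ) + 2) * j) := by
        rw [← zpow_add₀ h0]; congr 1; push_cast; ring
      rw [this]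
      ring
  exact ((Equiv.prodAssoc ℕ ℕ (Fin (r + 1) → ℕ)).symm.hasSum_iff.mpr hmain)

/-! ### The multisums in the whole unit disc -/

theorem innerSummand_zero {q : ℂ} (hq : ‖q‖ < 1) (ε r Δ : ℕ) : innerSummand q ε r Δ 0 0 = 1 := by
  have hq' : ‖q ^ 2‖ < 1 := by rw [norm_pow]; exact pow_lt_one₀ (norm_nonneg q) hq two_ne_zero
  have he : ∀ j, entry (0 : Fin (r + 1) → ℕ) j = 0 := fun j => by simp [entry]
  have ht : ∀ j, tailSum (0 : Fin (r + 1) → ℕ) j = 0 := fun j => by simp [tailSum, he]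
  rw [innerSummand, prod_eq_one fun j hj => ?_]
  · simp [he, ht, qBinom_zero hq']
  · rw [mem_Icc] at hj
    simp only [he, ht, Nat.cast_zero, sum_const_zero]
    exact qBinom_zero hq (by omega)

/-- At `q = 0` only the term with all summation variables zero survives. -/
theorem hasSum_multisum_at_zero (ε r : ℕ) {E : ℕ × ℕ → ℕ} {c : ℕ × ℕ → ℂ} {Δ K : ℕ → ℕ}
    (hE : ∀ p, p ≠ (0, 0) → E p ≠ 0) (hE0 : E (0, 0) = 0) (hc : c (0, 0) = 1) (hK : K 0 = 0) :
    HasSum (fun x : ℕ × ℕ × (Fin (r + 1) → ℕ) => (0 : ℂ) ^ E (x.1, x.2.1) * c (x.1, x.2.1)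
      * innerSummand 0 ε r (Δ x.2.1) (K x.2.1) x.2.2) 1 := by
  have h01 : ‖(0 : ℂ)‖ < 1 := by simp
  refine (hasSum_single (0, 0, 0) ?_).of_eq (fun _ => rfl) ?_
  · rintro ⟨m, k, n⟩ hx
    by_cases hp : (m, k) = (0, 0)
    · obtain ⟨rfl, rfl⟩ := Prod.mk.inj hp
      obtain ⟨C, hC0, hC⟩ := exists_norm_innerSummand_le h01 ε r
      have hn : ∑ i, n i ≠ 0 := by
        intro h
        refine hx ?_
        rw [show n = 0 from funext fun i => (sum_eq_zero_iff.mp h) i (mem_univ i)]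
      have h := hC (Δ 0) (K 0) n
      rw [norm_zero, zero_pow hn, zero_mul, norm_le_zero_iff] at h
      simp only [h, mul_zero]
    · simp only
      rw [zero_pow (hE _ hp), zero_mul, zero_mul]
  · simp only
    rw [hE0, hc, hK, Nat.cast_zero, innerSummand_zero h01]
    simp

theorem qPochInf_quotient_at_zero {a b c : ℕ} (ha : a ≠ 0) (hb : b ≠ 0) (hc : c ≠ 0) :
    qPochInf ((0 : ℂ) ^ a) (0 ^ a) * qPochInf (0 ^ b) (0 ^ a) * qPochInf (0 ^ c) (0 ^ a)
      / qPochInf 0 0 = 1 := by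
  have h : ∀ p, qPochInf 0 p = 1 := fun p => by simp [qPochInf]
  rw [zero_pow ha, zero_pow hb, zero_pow hc, h]
  norm_num

/-- The multisum with quadratic exponents, in terms of the exponents `α` and `β` of the product. -/
theorem hasSum_quadratic_multisum_product {q : ℂ} (hq : ‖q‖ < 1) {ε : ℕ} (hε : ε ≤ 1)
    {r Δ α β : ℕ} (hΔ : Δ ≤ r + 1) (hα : 0 < α)
    (hαγ : α + Δ * (2 * (r + 2) + ε) = (r + 2) * (2 * (r + 2) + 1))
    (hβ : β = (r + 2) * (2 * (r + 2) + 1) + Δ * (2 * (r + 2) + ε)) :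
    HasSum (fun x : ℕ × ℕ × (Fin (r + 1) → ℕ) =>
      q ^ ((x.1 + x.2.1) ^ 2 + x.2.1 ^ 2 + Δ * (x.1 + 2 * x.2.1))
        * (1 / (qPoch q q x.1 * qPoch q q (2 * x.2.1 + Δ)))
        * innerSummand q ε r Δ x.2.1 x.2.2)
      (qPochInf (q ^ (2 * (r + 2) * (2 * (r + 2) + 1))) (q ^ (2 * (r + 2) * (2 * (r + 2) + 1)))
        * qPochInf (q ^ α) (q ^ (2 * (r + 2) * (2 * (r + 2) + 1)))
        * qPochInf (q ^ β) (q ^ (2 * (r + 2) * (2 * (r + 2) + 1))) / qPochInf q q) := by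
  by_cases h0 : q = 0
  · subst h0
    rw [qPochInf_quotient_at_zero (by positivity) hα.ne' (by rw [hβ]; positivity)]
    refine hasSum_multisum_at_zero (E := fun p => (p.1 + p.2) ^ 2 + p.2 ^ 2 + Δ * (p.1 + 2 * p.2))
      (c := fun p => 1 / (qPoch 0 0 p.1 * qPoch 0 0 (2 * p.2 + Δ))) (Δ := fun _ => Δ)
      (K := fun k => k) ε r (fun p hp hE => hp ?_) (by simp) (by simp [qPoch]) rfl
    obtain ⟨m, k⟩ := p
    simp only [Nat.add_eq_zero_iff, pow_eq_zero_iff two_ne_zero] at hE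
    rw [hE.1.1.1, hE.1.1.2]
  · exact hasSum_quadratic_multisum h0 hq hε hΔ (hasSum_theta h0 hq hα hαγ hβ)

/-- The multisum with triangular exponents, for every `q` in the unit disc. -/
theorem hasSum_triangular_multisum_product {q : ℂ} (hq : ‖q‖ < 1) (r : ℕ) :
    HasSum (fun x : ℕ × ℕ × (Fin (r + 1) → ℕ) =>
      q ^ ((x.1 + 1).choose 2 + (x.1 + x.2.1 + 1).choose 2)
        * (1 / (qPoch q q x.1 * qPoch q q x.2.1))
        * innerSummand q 0 r (x.2.1 % 2) (x.2.1 / 2 : ℕ) x.2.2)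
      (qPochInf (q ^ (2 * (r + 2) * (2 * (r + 2) + 1))) (q ^ (2 * (r + 2) * (2 * (r + 2) + 1)))
        * qPochInf (q ^ (2 * (r + 2) ^ 2)) (q ^ (2 * (r + 2) * (2 * (r + 2) + 1)))
        * qPochInf (q ^ (2 * (r + 2) * (r + 2 + 1))) (q ^ (2 * (r + 2) * (2 * (r + 2) + 1)))
        / qPochInf q q) := by
  by_cases h0 : q = 0
  · subst h0
    rw [qPochInf_quotient_at_zero (by positivity) (by positivity) (by positivity)]
    refine hasSum_multisum_at_zero
      (E := fun p => (p.1 + 1).choose 2 + (p.1 + p.2 + 1).choose 2)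
      (c := fun p => 1 / (qPoch 0 0 p.1 * qPoch 0 0 p.2)) (Δ := fun k => k % 2)
      (K := fun k => k / 2) 0 r (fun p hp hE => hp ?_) (by simp) (by simp [qPoch]) rfl
    obtain ⟨m, k⟩ := p
    rw [Nat.add_eq_zero_iff, Nat.choose_eq_zero_iff, Nat.choose_eq_zero_iff] at hE
    simp only [Prod.mk.injEq]
    omega
  · exact hasSum_triangular_multisum h0 hq (hasSum_theta (v := r + 2) h0 hq (by positivity)
      (by ring) (by ring))

theorem mainTheorem4 (v : ℕ) (hv : 2 ≤ v) (q : ℂ) (hq : ‖q‖ < 1) :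
    (∀ Δ : ℕ, Δ < v →
      HasSum
        (fun x : ℕ × ℕ × (Fin (v - 1) → ℕ) =>
          let m := x.1
          let k := x.2.1
          let n := entry x.2.2
          let N := tailSum x.2.2
          q ^ ((m + k) ^ 2 + k ^ 2 + Δ * (m + 2 * k) + ∑ j ∈ Finset.Icc 1 (v - 1), N j ^ 2
              + ∑ t ∈ Finset.Icc (v - Δ) (v - 1), N t)
            * (1 / (qPoch q q m * qPoch q q (2 * k + Δ)))
            * qBinom (q ^ 2) ((k : ℤ) - ∑ t ∈ Finset.Icc 1 (v - 2), (N t : ℤ)) (n (v - 1))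
            * ∏ j ∈ Finset.Icc 1 (v - 2),
                qBinom q ((n j : ℤ) + 2 * k - 2 * ∑ t ∈ Finset.Icc 1 j, (N t : ℤ)
                  + min (Δ : ℤ) ((v : ℤ) - 1 - j)) (n j))
        (qPochInf (q ^ (2 * v * (2 * v + 1))) (q ^ (2 * v * (2 * v + 1)))
          * qPochInf (q ^ ((2 * v + 1) * (v - Δ))) (q ^ (2 * v * (2 * v + 1)))
          * qPochInf (q ^ ((2 * v + 1) * (v + Δ))) (q ^ (2 * v * (2 * v + 1)))
          / qPochInf q q)) ∧
    (∀ Δ : ℕ, Δ < v →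
      HasSum
        (fun x : ℕ × ℕ × (Fin (v - 1) → ℕ) =>
          let m := x.1
          let k := x.2.1
          let n := entry x.2.2
          let N := tailSum x.2.2
          q ^ (k ^ 2 + (m + k) ^ 2 + (m + 2 * k) * Δ + ∑ j ∈ Finset.Icc 1 (v - 1), N j ^ 2)
            * (1 / (qPoch q q m * qPoch q q (2 * k + Δ)))
            * qBinom (q ^ 2) ((k : ℤ) - ∑ t ∈ Finset.Icc 1 (v - 2), (N t : ℤ)) (n (v - 1))
            * ∏ j ∈ Finset.Icc 1 (v - 2),
                qBinom q ((n j : ℤ) + 2 * k - 2 * ∑ t ∈ Finset.Icc 1 j, (N t : ℤ)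
                  + min (Δ : ℤ) ((v : ℤ) - 1 - j)) (n j))
        (qPochInf (q ^ (2 * v * (2 * v + 1))) (q ^ (2 * v * (2 * v + 1)))
          * qPochInf (q ^ (v * (2 * v + 1 - 2 * Δ))) (q ^ (2 * v * (2 * v + 1)))
          * qPochInf (q ^ (v * (2 * v + 1 + 2 * Δ))) (q ^ (2 * v * (2 * v + 1)))
          / qPochInf q q)) ∧
    HasSum
      (fun x : ℕ × ℕ × (Fin (v - 1) → ℕ) =>
        let m := x.1
        let k := x.2.1
        let n := entry x.2.2
        let N := tailSum x.2.2
        q ^ ((m + 1).choose 2 + (m + k + 1).choose 2 + ∑ j ∈ Finset.Icc 1 (v - 1), N j ^ 2)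
          * (1 / (qPoch q q m * qPoch q q k))
          * qBinom (q ^ 2) (((k / 2 : ℕ) : ℤ) - ∑ t ∈ Finset.Icc 1 (v - 2), (N t : ℤ))
              (n (v - 1))
          * ∏ j ∈ Finset.Icc 1 (v - 2),
              qBinom q ((n j : ℤ) + k - 2 * ∑ t ∈ Finset.Icc 1 j, (N t : ℤ)) (n j))
      (qPochInf (q ^ (2 * v * (2 * v + 1))) (q ^ (2 * v * (2 * v + 1)))
        * qPochInf (q ^ (2 * v ^ 2)) (q ^ (2 * v * (2 * v + 1)))
        * qPochInf (q ^ (2 * v * (v + 1))) (q ^ (2 * v * (2 * v + 1)))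
        / qPochInf q q) := by
  obtain ⟨r, rfl⟩ : ∃ r, v = r + 2 := ⟨v - 2, by omega⟩
  refine ⟨fun Δ hΔ => ?_, fun Δ hΔ => ?_, ?_⟩
  · have key : ∀ (m k : ℕ) (n : Fin (r + 1) → ℕ),
        q ^ ((m + k) ^ 2 + k ^ 2 + Δ * (m + 2 * k) + ∑ j ∈ Icc 1 (r + 1), tailSum n j ^ 2
            + ∑ t ∈ Icc (r + 2 - Δ) (r + 1), tailSum n t)
          * (1 / (qPoch q q m * qPoch q q (2 * k + Δ)))
          * qBinom (q ^ 2) ((k : ℤ) - ∑ t ∈ Icc 1 r, (tailSum n t : ℤ)) (entry n (r + 1))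
          * ∏ j ∈ Icc 1 r, qBinom q ((entry n j : ℤ) + 2 * k
              - 2 * ∑ t ∈ Icc 1 j, (tailSum n t : ℤ)
              + min (Δ : ℤ) (((r + 2 : ℕ) : ℤ) - 1 - j)) (entry n j)
        = q ^ ((m + k) ^ 2 + k ^ 2 + Δ * (m + 2 * k))
          * (1 / (qPoch q q m * qPoch q q (2 * k + Δ))) * innerSummand q 1 r Δ k n := by
      intro m k n
      rw [innerSummand, add_assoc, pow_add q ((m + k) ^ 2 + _ + _), one_mul,
        show ((r + 2 : ℕ) : ℤ) - 1 = r + 1 by push_cast; ring]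
      ring
    refine (hasSum_quadratic_multisum_product hq le_rfl (by omega)
      (α := (2 * (r + 2) + 1) * (r + 2 - Δ)) (β := (2 * (r + 2) + 1) * (r + 2 + Δ))
      (Nat.mul_pos (by omega) (by omega)) ?_ (by ring)).of_eq (fun x => key x.1 x.2.1 x.2.2) rfl
    obtain ⟨d, hd⟩ := Nat.exists_eq_add_of_lt hΔ
    rw [show r + 2 - Δ = d + 1 by omega, hd]
    ring
  · have key : ∀ (m k : ℕ) (n : Fin (r + 1) → ℕ),
        q ^ (k ^ 2 + (m + k) ^ 2 + (m + 2 * k) * Δ + ∑ j ∈ Icc 1 (r + 1), tailSum n j ^ 2)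
          * (1 / (qPoch q q m * qPoch q q (2 * k + Δ)))
          * qBinom (q ^ 2) ((k : ℤ) - ∑ t ∈ Icc 1 r, (tailSum n t : ℤ)) (entry n (r + 1))
          * ∏ j ∈ Icc 1 r, qBinom q ((entry n j : ℤ) + 2 * k
              - 2 * ∑ t ∈ Icc 1 j, (tailSum n t : ℤ)
              + min (Δ : ℤ) (((r + 2 : ℕ) : ℤ) - 1 - j)) (entry n j)
        = q ^ ((m + k) ^ 2 + k ^ 2 + Δ * (m + 2 * k))
          * (1 / (qPoch q q m * qPoch q q (2 * k + Δ))) * innerSummand q 0 r Δ k n := by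
      intro m k n
      rw [innerSummand, pow_add q (k ^ 2 + _ + _), zero_mul, add_zero,
        show ((r + 2 : ℕ) : ℤ) - 1 = r + 1 by push_cast; ring,
        show k ^ 2 + (m + k) ^ 2 + (m + 2 * k) * Δ
          = (m + k) ^ 2 + k ^ 2 + Δ * (m + 2 * k) by ring]
      ring
    refine (hasSum_quadratic_multisum_product hq zero_le_one (by omega)
      (α := (r + 2) * (2 * (r + 2) + 1 - 2 * Δ)) (β := (r + 2) * (2 * (r + 2) + 1 + 2 * Δ))
      (Nat.mul_pos (by omega) (by omega)) ?_ (by ring)).of_eq (fun x => key x.1 x.2.1 x.2.2) rfl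
    obtain ⟨d, hd⟩ := Nat.exists_eq_add_of_lt hΔ
    rw [show 2 * (r + 2) + 1 - 2 * Δ = 2 * d + 3 by omega, hd]
    ring
  · have key : ∀ (m k : ℕ) (n : Fin (r + 1) → ℕ),
        q ^ ((m + 1).choose 2 + (m + k + 1).choose 2 + ∑ j ∈ Icc 1 (r + 1), tailSum n j ^ 2)
          * (1 / (qPoch q q m * qPoch q q k))
          * qBinom (q ^ 2) (((k / 2 : ℕ) : ℤ) - ∑ t ∈ Icc 1 r, (tailSum n t : ℤ)) (entry n (r + 1))
          * ∏ j ∈ Icc 1 r, qBinom q ((entry n j : ℤ) + k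
              - 2 * ∑ t ∈ Icc 1 j, (tailSum n t : ℤ)) (entry n j)
        = q ^ ((m + 1).choose 2 + (m + k + 1).choose 2)
          * (1 / (qPoch q q m * qPoch q q k))
          * innerSummand q 0 r (k % 2) (k / 2 : ℕ) n := by
      intro m k n
      rw [innerSummand, pow_add q ((m + 1).choose 2 + _), zero_mul, add_zero]
      -- `min (k % 2) (r + 1 - j) = k % 2`, since `j ≤ r`
      rw [prod_congr rfl fun j hj => show qBinom q ((entry n j : ℤ) + k
          - 2 * ∑ t ∈ Icc 1 j, (tailSum n t : ℤ)) (entry n j)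
          = qBinom q ((entry n j : ℤ) + 2 * (k / 2 : ℕ) - 2 * ∑ t ∈ Icc 1 j, (tailSum n t : ℤ)
            + min ((k % 2 : ℕ) : ℤ) ((r : ℤ) + 1 - j)) (entry n j) by
        rw [mem_Icc] at hj
        congr 1
        omega]
      ring
    exact (hasSum_triangular_multisum_product hq r).of_eq (fun x => key x.1 x.2.1 x.2.2) rfl
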